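/- For a set $V$ of laws, a group $G$, and a free presentation $G\cong F/R$ with $F$ a free group, the Baer invariant of $G$ with respect to the variety $\mathfrak V$ defined by $V$ is $$\mathfrak V M(G)=\frac{R\cap V(F)}{[RV^*F]},$$ where $V(F)$ is the verbal subgroup of $F$ and $[RV^*F]$ is the subgroup generated by all elements $v(f_1,\ldots,f_ir,\ldots,f_s)\,v(f_1,\ldots,f_i,\ldots,f_s)^{-1}$ with $v=v(x_1,\ldots,x_s)\in V$, $1\le i\le s$, $r\in R$ and $f_1,\ldots,f_s\in F$. For $c_1,c_2\ge 1$ let $[\mathfrak N_{c_1},\mathfrak N_{c_2}]$ be the variety defined by the single law $[[x_1,\ldots,x_{c_1+1}],[y_1,\ldots,y_{c_2+1}]]$, where the inner commutators are left-normed. For $n\ge 1$ let $$\chi_n(d)=\frac1n\sum_{m\mid n}\mu(m)\,d^{\,n/m}$$ be Witt's function, with $\mu$ the Möbius function. For a group $X$, $X^{(m)}$ denotes the direct sum of $m$ copies of $X$, and $\mathbb Z_m=\mathbb Z/m\mathbb Z$. **Theorem 2.6.** Let $G\cong\mathbb Z^{(k)}\oplus\mathbb Z_{n_1}\oplus\cdots\oplus\mathbb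 Z_{n_t}$, where $k,t\ge 0$ are integers and $n_1,\ldots,n_t$ are positive integers with $n_{i+1}\mid n_i$ for $1\le i\le t-1$. Let $c_1,c_2\ge 1$ be integers with $c_2\le c_1\le 2c_2$. For each integer $i\ge 0$ put $$b_i=\begin{cases}\chi_{c_1+1}(i)\,\chi_{c_2+1}(i) & \text{if } c_1>c_2,\\ \chi_2\bigl(\chi_{c_1+1}(i)\bigr) & \text{if } c_1=c_2.\end{cases}$$ Then $(b_i)_{i\ge 0}$ is a non-decreasing sequence of non-negative integers and, for every free presentation of $G$, $$[\mathfrak N_{c_1},\mathfrak N_{c_2}]M(G)\cong\mathbb Z^{(b_k)}\oplus\mathbb Z_{n_1}^{(b_{k+1}-b_k)}\oplus\mathbb Z_{n_2}^{(b_{k+2}-b_{k+1})}\oplus\cdots\oplus\mathbb Z_{n_t}^{(b_{k+t}-b_{k+t-1})}.$$ -/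

import Mathlib

open scoped commutatorElement

/-- The verbal subgroup `V(F)` of a group `F` for a set `V` of words in countably many variables:
it is generated by all values `v(f₀, f₁, …)` of words `v ∈ V` in `F`. -/
def verbalSubgroup (V : Set (FreeGroup ℕ)) (F : Type*) [Group F] : Subgroup F :=
  Subgroup.closure {x | ∃ v ∈ V, ∃ f : ℕ → F, x = FreeGroup.lift f v}

/-- The subgroup `[R V* F]`, generated by all elements
`v(f₀, …, fᵢ r, …) v(f₀, …, fᵢ, …)⁻¹` with `v ∈ V`, `r ∈ R` and all `fⱼ ∈ F`. -/
def marginalCommutator (V : Set (FreeGroup ℕ)) {F : Type*} [Group F] (R : Subgroup F) :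
    Subgroup F :=
  Subgroup.closure {x | ∃ v ∈ V, ∃ f : ℕ → F, ∃ i : ℕ, ∃ r ∈ R,
    x = FreeGroup.lift (Function.update f i (f i * r)) v * (FreeGroup.lift f v)⁻¹}

theorem lift_conj_apply {F : Type*} [Group F] (g : F) (f : ℕ → F) (v : FreeGroup ℕ) :
    FreeGroup.lift (fun j => g * f j * g⁻¹) v = g * FreeGroup.lift f v * g⁻¹ := by
  have h : FreeGroup.lift (fun j => g * f j * g⁻¹)
      = (MulAut.conj g).toMonoidHom.comp (FreeGroup.lift f) := by
    ext j; simp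
  rw [h]; simp

instance marginalCommutator_normal (V : Set (FreeGroup ℕ)) {F : Type*} [Group F]
    (R : Subgroup F) [hR : R.Normal] : (marginalCommutator V R).Normal := by
  constructor
  intro x hx g
  have hle : marginalCommutator V R
      ≤ (marginalCommutator V R).comap (MulAut.conj g).toMonoidHom := by
    unfold marginalCommutator
    rw [Subgroup.closure_le]
    rintro _ ⟨v, hv, f, i, r, hr, rfl⟩
    apply Subgroup.subset_closure
    refine ⟨v, hv, fun j => g * f j * g⁻¹, i, g * r * g⁻¹, hR.conj_mem r hr g, ?_⟩
    have h : Function.update (fun j => g * f j * g⁻¹) i (g * f i * g⁻¹ * (g * r * g⁻¹))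
        = fun j => g * Function.update f i (f i * r) j * g⁻¹ := by
      funext j
      by_cases hj : j = i
      · subst hj; simp [mul_assoc]
      · simp [hj]
    rw [h, lift_conj_apply, lift_conj_apply]
    simp [mul_assoc]
  simpa using hle hx

/-- `[R V* F]` is contained in `R ∩ V(F)`. -/
theorem marginalCommutator_le (V : Set (FreeGroup ℕ)) {F : Type*} [Group F]
    (R : Subgroup F) [R.Normal] : marginalCommutator V R ≤ R ⊓ verbalSubgroup V F := by
  unfold marginalCommutator
  rw [Subgroup.closure_le]
  rintro _ ⟨v, hv, f, i, r, hr, rfl⟩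
  refine Subgroup.mem_inf.2 ⟨?_, (verbalSubgroup V F).mul_mem
    (Subgroup.subset_closure ⟨v, hv, _, rfl⟩)
    ((verbalSubgroup V F).inv_mem (Subgroup.subset_closure ⟨v, hv, _, rfl⟩))⟩
  have h : (QuotientGroup.mk' R).comp (FreeGroup.lift (Function.update f i (f i * r)))
      = (QuotientGroup.mk' R).comp (FreeGroup.lift f) := by
    ext j
    by_cases hj : j = i
    · subst hj; simp [hr]
    · simp [hj]
  have h2 := DFunLike.congr_fun h v
  simp only [MonoidHom.comp_apply] at h2
  rw [← QuotientGroup.ker_mk' R, MonoidHom.mem_ker, map_mul, map_inv, h2,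
    mul_inv_cancel]

/-- The Baer invariant `(R ∩ V(F)) / [R V* F]`, with respect to the variety defined by the laws `V`,
computed from the presentation `F / R`. -/
abbrev BaerInvariant (V : Set (FreeGroup ℕ)) {F : Type*} [Group F] (R : Subgroup F) : Type _ :=
  ↥(R ⊓ verbalSubgroup V F) ⧸ (marginalCommutator V R).subgroupOf (R ⊓ verbalSubgroup V F)

/-- The left-normed commutator `[x_s, x_{s+1}, …, x_{s+c}]` of weight `c + 1`; it defines the
variety of nilpotent groups of class at most `c`. -/
def nilpotentWord (s : ℕ) : ℕ → FreeGroup ℕ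
  | 0 => FreeGroup.of s
  | c + 1 => ⁅nilpotentWord s c, FreeGroup.of (s + c + 1)⁆

/-- The defining law of the variety `[𝔑_{c₁}, 𝔑_{c₂}]`: the commutator of the defining words of
`𝔑_{c₁}` and `𝔑_{c₂}`, written in disjoint sets of variables. -/
def outerNilpotentLaws (c₁ c₂ : ℕ) : Set (FreeGroup ℕ) :=
  {⁅nilpotentWord 0 c₁, nilpotentWord (c₁ + 1) c₂⁆}

/-- Witt's function `χ_n(d) = (1/n) ∑_{m ∣ n} μ(m) d^{n/m}`. -/
def wittChi (n : ℕ) (d : ℚ) : ℚ :=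
  (1 / (n : ℚ)) * ∑ m ∈ n.divisors, (ArithmeticFunction.moebius m : ℚ) * d ^ (n / m)

/-! Write γ_n for the lower central series of a free group F on m = k + t letters, R for the kernel
of the standard map of F onto G, and M for [R V* F]. Since F/R is abelian, γ_{n+1} lies in the
weight-n term of the series R, [R, F], [[R, F], F], …. Hence V(F) = [γ_{c₁+1}, γ_{c₂+1}] is central
modulo M (`commutator_verbalSubgroup_top_le`), and the Baer invariant is abelian, generated by
commutators [a, b] in which a and b need only run through generators of γ_{c₁+1} modulo γ_{c₁+2} and
of γ_{c₂+1} modulo γ_{c₂+2}.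

Lazard elimination supplies these generators. Eliminating a letter s₀ replaces the alphabet by all
[s, s₀, …, s₀] with s ≠ s₀. Doing this for every letter of weight at most c₂ leaves bracket
arrangements of weight at least c₂ + 1 which freely generate a subalgebra of the free associative
algebra (`IsFreeFamily.elim`) and still span the factors γ_n/γ_{n+1} for n > c₂
(`bracketSpan_le_elim`). As c₁ + 1 < 2(c₂ + 1), the factors of weights c₁ + 1 and c₂ + 1 are spanned
by single letters of this one alphabet, so the generators of the Baer invariant are commutators [u,
v] of two free letters, one for each unordered pair.

Let N_i be the order of the i-th generator of G, with 0 for infinite order, so that N_j ∣ N_i for i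
≤ j. If j is the largest original letter occurring in u and v, then [u, v]^{N_j} ∈ M. There are no
further relations: the leading Magnus coefficient over ℤ/N_j, with all letters after j sent to 0,
kills M, and brackets of distinct pairs of free letters are linearly independent
(`IsFreeFamily.eq_zero_of_sum_bracket`). The invariant is therefore the direct sum of the ℤ/N_j over
all pairs.

It remains to count pairs by their largest letter. Each elimination divides the series 1 − ∑ (number
of letters of weight n) Xⁿ by 1 − X^w, and a logarithmic derivative followed by Möbius inversion
gives Witt's formula (`letterCount_eq_wittChi`). Finally, the Baer invariant is the same for all
free presentations (`nonempty_baerInvariant_ker_mulEquiv`). -/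

namespace OuterNilpotent

/-! ### Commutator calculus and the series R, [R, F], [[R, F], F], … -/

section GroupTheory

variable {F : Type*} [Group F]

theorem normal_of_commutator_top_le {K : Subgroup F} (h : ⁅K, (⊤ : Subgroup F)⁆ ≤ K) :
    K.Normal := by
  constructor
  intro x hx g
  have h1 : ⁅x, g⁆ ∈ K := h (Subgroup.commutator_mem_commutator hx (Subgroup.mem_top g))
  have h2 : g * x * g⁻¹ = ⁅x, g⁆⁻¹ * x := by simp [commutatorElement_def, mul_assoc]
  rw [h2]
  exact K.mul_mem (K.inv_mem h1) hx

/-- Modulo `N` the generators commute, and centralizers see only generators. -/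
theorem commutator_closure_le {N : Subgroup F} [hN : N.Normal] {C D : Set F}
    (h : ∀ c ∈ C, ∀ d ∈ D, ⁅c, d⁆ ∈ N) : ⁅Subgroup.closure C, Subgroup.closure D⁆ ≤ N := by
  rw [← QuotientGroup.ker_mk' N, ← Subgroup.map_eq_bot_iff, Subgroup.map_commutator,
    Subgroup.commutator_eq_bot_iff_le_centralizer, MonoidHom.map_closure, MonoidHom.map_closure,
    Subgroup.centralizer_closure, Subgroup.closure_le]
  rintro _ ⟨c, hc, rfl⟩
  simp only [SetLike.mem_coe]
  rintro _ ⟨d, hd, rfl⟩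
  have h1 := h c hc d hd
  rw [← QuotientGroup.ker_mk' N, MonoidHom.mem_ker, map_commutatorElement,
    commutatorElement_eq_one_iff_mul_comm] at h1
  exact h1.symm

/-- The three subgroups lemma modulo a normal subgroup. -/
theorem commutator_commutator_le_of_rotate {N A B C : Subgroup F} [N.Normal]
    (h1 : ⁅⁅B, C⁆, A⁆ ≤ N) (h2 : ⁅⁅C, A⁆, B⁆ ≤ N) : ⁅⁅A, B⁆, C⁆ ≤ N := by
  rw [← QuotientGroup.ker_mk' N, ← Subgroup.map_eq_bot_iff, Subgroup.map_commutator,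
    Subgroup.map_commutator] at h1 h2 ⊢
  exact Subgroup.commutator_commutator_eq_bot_of_rotate h1 h2

theorem pow_commutatorElement_of_commute {a b : F} (h : Commute a ⁅a, b⁆) (n : ℕ) :
    ⁅a ^ n, b⁆ = ⁅a, b⁆ ^ n := by
  induction n with
  | zero => simp
  | succ n ih =>
    rw [pow_succ, commutatorElement_mul_left_eq_conj_mul, (h.pow_left n).eq, ih,
      mul_inv_cancel_right, pow_succ']

/-- Modulo `N` the element `a` commutes with `⁅a, b⁆`, so powers of `a` can be moved out of the
commutator. -/
theorem commutatorElement_pow_mem {N : Subgroup F} [N.Normal] {a b : F} (h : ⁅a, ⁅a, b⁆⁆ ∈ N)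
    {n : ℕ} (hn : ⁅a ^ n, b⁆ ∈ N) : ⁅a, b⁆ ^ n ∈ N := by
  rw [← QuotientGroup.ker_mk' N, MonoidHom.mem_ker] at h hn ⊢
  simp only [map_commutatorElement, map_pow] at h hn ⊢
  rwa [← pow_commutatorElement_of_commute (commutatorElement_eq_one_iff_commute.1 h)]

/-- The series `R, R, [R, F], [[R, F], F], …`, indexed by weight: for `R = ⊤` the `n`-th term is
the `n`-th term `γₙ(F)` of the lower central series. -/
def weightSeries (R : Subgroup F) : ℕ → Subgroup F
  | 0 => R
  | 1 => R
  | n + 2 => ⁅weightSeries R (n + 1), ⊤⁆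

variable (R : Subgroup F)

theorem weightSeries_succ_succ (n : ℕ) :
    weightSeries R (n + 2) = ⁅weightSeries R (n + 1), ⊤⁆ := by rw [weightSeries]

instance weightSeries_normal [hR : R.Normal] : ∀ n, (weightSeries R n).Normal
  | 0 => hR
  | 1 => hR
  | n + 2 => by
    have := weightSeries_normal (n + 1)
    rw [weightSeries_succ_succ]
    infer_instance

theorem weightSeries_antitone [hR : R.Normal] : Antitone (weightSeries R) := by
  refine antitone_nat_of_succ_le fun n => ?_
  rcases n with _ | n
  · exact le_rfl
  · rw [weightSeries_succ_succ]
    exact Subgroup.commutator_le_left _ _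

theorem commutator_weightSeries_le [R.Normal] (m n : ℕ) :
    ⁅weightSeries R m, weightSeries (⊤ : Subgroup F) n⁆ ≤ weightSeries R (m + n) := by
  induction n generalizing m with
  | zero => exact Subgroup.commutator_le_left _ _
  | succ n ih =>
    rcases n with _ | n
    · rcases m with _ | m
      · exact Subgroup.commutator_le_left _ _
      · exact (weightSeries_succ_succ R m).ge
    · have key (m : ℕ) : ⁅weightSeries R (m + 1), weightSeries (⊤ : Subgroup F) (n + 2)⁆
          ≤ weightSeries R (m + 1 + (n + 2)) := by
        rw [weightSeries_succ_succ, Subgroup.commutator_comm]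
        refine commutator_commutator_le_of_rotate ?_ ?_
        · rw [Subgroup.commutator_comm ⊤, ← weightSeries_succ_succ]
          exact (ih (m + 2)).trans (weightSeries_antitone R (by omega))
        · refine (Subgroup.commutator_mono (ih (m + 1)) le_rfl).trans ?_
          rw [show m + 1 + (n + 1) = (m + n + 1) + 1 by ring, ← weightSeries_succ_succ]
          exact weightSeries_antitone R (by omega)
      rcases m with _ | m
      · exact (key 0).trans (weightSeries_antitone R (by omega))
      · exact key m

theorem commutator_weightSeries_le' [R.Normal] {m n l : ℕ} (h : l ≤ m + n) :
    ⁅weightSeries R m, weightSeries (⊤ : Subgroup F) n⁆ ≤ weightSeries R l :=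
  (commutator_weightSeries_le R m n).trans (weightSeries_antitone R h)

/-- An abelian quotient costs one weight: one extra factor from `F` buys a first entry in `R`. This
is what makes terms of higher weight negligible modulo `[R V* F]`. -/
theorem weightSeries_top_le {R : Subgroup F} (h : _root_.commutator F ≤ R) (n : ℕ) :
    weightSeries (⊤ : Subgroup F) (n + 2) ≤ weightSeries R (n + 1) := by
  induction n with
  | zero => exact h
  | succ n ih =>
    rw [weightSeries_succ_succ, weightSeries_succ_succ R]
    exact Subgroup.commutator_mono ih le_rfl

end GroupTheory

/-! ### Bracket arrangements and elimination of a letter -/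

section Brackets

/-- The value of a bracket arrangement in a structure with a bracket (a group, a Lie ring). -/
def bracketEval {S A : Type*} [Bracket A A] (f : S → A) : FreeMagma S → A
  | .of s => f s
  | .mul x y => ⁅bracketEval f x, bracketEval f y⁆

/-- The left-normed bracket `[a, b, …, b]` with `k` entries `b`. -/
def iterBracket {A : Type*} [Bracket A A] (a b : A) : ℕ → A
  | 0 => a
  | k + 1 => ⁅iterBracket a b k, b⁆

/-- The weight of a bracket arrangement whose letters have given weights. -/
def treeWeight {S : Type*} (wt : S → ℕ) : FreeMagma S → ℕ
  | .of s => wt s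
  | .mul x y => treeWeight wt x + treeWeight wt y

/-- The family obtained from `f` by eliminating `s₀`: all `[f s, f s₀, …, f s₀]`, `s ≠ s₀`. -/
def elimFamily {S A : Type*} [Bracket A A] (f : S → A) (s₀ : S) (s : {s // s ≠ s₀} × ℕ) : A :=
  iterBracket (f s.1) (f s₀) s.2

/-- The weights of the family obtained by eliminating `s₀`. -/
def elimWeight {S : Type*} (wt : S → ℕ) (s₀ : S) (s : {s // s ≠ s₀} × ℕ) : ℕ :=
  wt s.1 + s.2 * wt s₀

theorem treeWeight_ge {S : Type*} {wt : S → ℕ} {q : ℕ} (h : ∀ s, q ≤ wt s) (t : FreeMagma S) :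
    q ≤ treeWeight wt t := by
  induction t with
  | ih1 s => exact h s
  | ih2 x y hx _ => exact hx.trans (Nat.le_add_right _ _)

end Brackets

/-! ### Elimination in groups: spanning the lower central factors -/

section Span

variable {F : Type*} [Group F] {S : Type*}

theorem bracketEval_mem_weightSeries {g : S → F} {wt : S → ℕ}
    (hg : ∀ s, g s ∈ weightSeries (⊤ : Subgroup F) (wt s)) (t : FreeMagma S) :
    bracketEval g t ∈ weightSeries (⊤ : Subgroup F) (treeWeight wt t) := by
  induction t with
  | ih1 s => exact hg s
  | ih2 x y hx hy =>
    exact commutator_weightSeries_le ⊤ _ _ (Subgroup.commutator_mem_commutator hx hy)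

theorem iterBracket_mem_weightSeries {a b : F} {m n : ℕ}
    (ha : a ∈ weightSeries (⊤ : Subgroup F) m) (hb : b ∈ weightSeries (⊤ : Subgroup F) n) (k : ℕ) :
    iterBracket a b k ∈ weightSeries (⊤ : Subgroup F) (m + k * n) := by
  induction k with
  | zero => simpa [iterBracket] using ha
  | succ k ih =>
    have := commutator_weightSeries_le ⊤ _ _ (Subgroup.commutator_mem_commutator ih hb)
    rwa [add_assoc, ← Nat.succ_mul] at this

/-- The subgroup generated by a set `C` and the `(n+1)`-st term of the lower central series. -/
def thicken (C : Set F) (n : ℕ) : Subgroup F :=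
  Subgroup.closure (C ∪ weightSeries (⊤ : Subgroup F) (n + 1))

theorem subset_thicken {C : Set F} {n : ℕ} : C ⊆ thicken C n :=
  Set.subset_union_left.trans Subgroup.subset_closure

theorem weightSeries_le_thicken {C : Set F} {n : ℕ} :
    weightSeries (⊤ : Subgroup F) (n + 1) ≤ thicken C n :=
  fun _ h => Subgroup.subset_closure (Or.inr h)

theorem thicken_le {C : Set F} {n : ℕ} {K : Subgroup F} (h : C ⊆ K)
    (h' : weightSeries (⊤ : Subgroup F) (n + 1) ≤ K) : thicken C n ≤ K :=
  (Subgroup.closure_le _).2 (Set.union_subset h h')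

theorem thicken_normal {C : Set F} {n : ℕ}
    (h : C ⊆ weightSeries (⊤ : Subgroup F) n) : (thicken C n).Normal := by
  apply normal_of_commutator_top_le
  refine le_trans ?_ weightSeries_le_thicken
  refine le_trans ?_ (commutator_weightSeries_le ⊤ n 1)
  exact Subgroup.commutator_mono (thicken_le h (weightSeries_antitone _ n.le_succ)) le_rfl

/-- Every commutator involving a correction term has weight at least `m + n + 1`, so only
commutators of the chosen generators matter. -/
theorem commutator_thicken_le {C D : Set F} {m n : ℕ} {K : Subgroup F} [K.Normal]
    (hC : C ⊆ weightSeries (⊤ : Subgroup F) m) (hD : D ⊆ weightSeries (⊤ : Subgroup F) n)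
    (hK : weightSeries (⊤ : Subgroup F) (m + n + 1) ≤ K)
    (h : ∀ c ∈ C, ∀ d ∈ D, ⁅c, d⁆ ∈ K) : ⁅thicken C m, thicken D n⁆ ≤ K := by
  refine commutator_closure_le ?_
  rintro c (hc | hc) d (hd | hd)
  · exact h c hc d hd
  · exact hK (commutator_weightSeries_le' ⊤ (by omega)
      (Subgroup.commutator_mem_commutator (hC hc) hd))
  · exact hK (commutator_weightSeries_le' ⊤ (by omega)
      (Subgroup.commutator_mem_commutator hc (hD hd)))
  · exact hK (commutator_weightSeries_le' ⊤ (by omega)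
      (Subgroup.commutator_mem_commutator hc hd))

/-- The subgroup generated by the bracket arrangements of total weight `n` in the family `g`, and
the `(n+1)`-st term of the lower central series. -/
def bracketSpan (g : S → F) (wt : S → ℕ) (n : ℕ) : Subgroup F :=
  thicken {x | ∃ t, treeWeight wt t = n ∧ bracketEval g t = x} n

section

variable {g : S → F} {wt : S → ℕ} (hg : ∀ s, g s ∈ weightSeries (⊤ : Subgroup F) (wt s))
include hg

theorem setOf_bracketEval_subset (n : ℕ) :
    {x | ∃ t, treeWeight wt t = n ∧ bracketEval g t = x} ⊆
      (weightSeries (⊤ : Subgroup F) n : Set F) := by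
  rintro _ ⟨t, rfl, rfl⟩
  exact bracketEval_mem_weightSeries hg t

theorem bracketSpan_normal (n : ℕ) : (bracketSpan g wt n).Normal :=
  thicken_normal (setOf_bracketEval_subset hg n)

theorem commutator_bracketSpan_le (m n : ℕ) :
    ⁅bracketSpan g wt m, bracketSpan g wt n⁆ ≤ bracketSpan g wt (m + n) := by
  have := bracketSpan_normal hg (m + n)
  refine commutator_thicken_le (setOf_bracketEval_subset hg m) (setOf_bracketEval_subset hg n)
    weightSeries_le_thicken ?_
  rintro _ ⟨s, rfl, rfl⟩ _ ⟨t, rfl, rfl⟩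
  exact subset_thicken ⟨s * t, rfl, rfl⟩

theorem elimFamily_mem_weightSeries (s₀ : S) (s : {s // s ≠ s₀} × ℕ) :
    elimFamily g s₀ s ∈ weightSeries (⊤ : Subgroup F) (elimWeight wt s₀ s) :=
  iterBracket_mem_weightSeries (hg _) (hg _) _

/-- Bracketing with `g s₀` behaves like a derivation: it sends the letter `(s, j)` to `(s, j + 1)`,
and on products the three subgroups lemma plays the role of the Leibniz rule. -/
theorem commutator_bracketEval_elimFamily_mem (s₀ : S) (t : FreeMagma ({s // s ≠ s₀} × ℕ)) :
    ⁅bracketEval (elimFamily g s₀) t, g s₀⁆ ∈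
      bracketSpan (elimFamily g s₀) (elimWeight wt s₀)
        (treeWeight (elimWeight wt s₀) t + wt s₀) := by
  have hg' := elimFamily_mem_weightSeries hg s₀
  induction t with
  | ih1 s =>
    refine subset_thicken ⟨.of (s.1, s.2 + 1), ?_, rfl⟩
    simp only [treeWeight, elimWeight]
    ring
  | ih2 x y hx hy =>
    set E := bracketSpan (elimFamily g s₀) (elimWeight wt s₀)
    have hE (n : ℕ) : (E n).Normal := bracketSpan_normal hg' n
    set m := treeWeight (elimWeight wt s₀) x
    set n := treeWeight (elimWeight wt s₀) y
    have hxm := bracketEval_mem_weightSeries hg' x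
    have hyn := bracketEval_mem_weightSeries hg' y
    -- The three subgroups lemma is about subgroups, so each of the three elements is replaced by
    -- the subgroup it generates together with the next term of the lower central series.
    have hxE : thicken {bracketEval (elimFamily g s₀) x} m ≤ E m := by
      refine thicken_le ?_ weightSeries_le_thicken
      rw [Set.singleton_subset_iff]
      exact subset_thicken ⟨x, rfl, rfl⟩
    have hyE : thicken {bracketEval (elimFamily g s₀) y} n ≤ E n := by
      refine thicken_le ?_ weightSeries_le_thicken
      rw [Set.singleton_subset_iff]
      exact subset_thicken ⟨y, rfl, rfl⟩
    have hxZ : ⁅thicken {g s₀} (wt s₀), thicken {bracketEval (elimFamily g s₀) x} m⁆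
        ≤ E (m + wt s₀) := by
      rw [Subgroup.commutator_comm]
      refine commutator_thicken_le (by simpa using hxm) (by simpa using hg s₀)
        weightSeries_le_thicken ?_
      rintro _ rfl _ rfl
      exact hx
    have hyZ : ⁅thicken {bracketEval (elimFamily g s₀) y} n, thicken {g s₀} (wt s₀)⁆
        ≤ E (n + wt s₀) := by
      refine commutator_thicken_le (by simpa using hyn) (by simpa using hg s₀)
        weightSeries_le_thicken ?_
      rintro _ rfl _ rfl
      exact hy
    have key : ⁅⁅thicken {bracketEval (elimFamily g s₀) x} m,
        thicken {bracketEval (elimFamily g s₀) y} n⁆, thicken {g s₀} (wt s₀)⁆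
          ≤ E (m + n + wt s₀) := by
      refine commutator_commutator_le_of_rotate ?_ ?_
      · refine (Subgroup.commutator_mono hyZ hxE).trans ?_
        rw [show m + n + wt s₀ = n + wt s₀ + m by ring]
        exact commutator_bracketSpan_le hg' _ _
      · refine (Subgroup.commutator_mono hxZ hyE).trans ?_
        rw [show m + n + wt s₀ = m + wt s₀ + n by ring]
        exact commutator_bracketSpan_le hg' _ _
    exact key (Subgroup.commutator_mem_commutator (Subgroup.commutator_mem_commutator
      (subset_thicken rfl) (subset_thicken rfl)) (subset_thicken rfl))

/-- The one-letter tree `s₀` is the only arrangement that can be lost; as soon as it is bracketed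
with something else, the derivation property brings the result back into the span. -/
theorem bracketEval_mem_bracketSpan_elim (s₀ : S) (t : FreeMagma S) :
    t = .of s₀ ∨ bracketEval g t ∈
      bracketSpan (elimFamily g s₀) (elimWeight wt s₀) (treeWeight wt t) := by
  have hg' := elimFamily_mem_weightSeries hg s₀
  have hE (n : ℕ) : (bracketSpan (elimFamily g s₀) (elimWeight wt s₀) n).Normal :=
    bracketSpan_normal hg' n
  have key {x : F} {n : ℕ} (hx : x ∈ bracketSpan (elimFamily g s₀) (elimWeight wt s₀) n) :
      ⁅x, g s₀⁆ ∈ bracketSpan (elimFamily g s₀) (elimWeight wt s₀) (n + wt s₀) := by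
    have h : ⁅bracketSpan (elimFamily g s₀) (elimWeight wt s₀) n, thicken {g s₀} (wt s₀)⁆
        ≤ bracketSpan (elimFamily g s₀) (elimWeight wt s₀) (n + wt s₀) := by
      refine commutator_thicken_le (setOf_bracketEval_subset hg' n) (by simpa using hg s₀)
        weightSeries_le_thicken ?_
      rintro _ ⟨t, rfl, rfl⟩ _ rfl
      exact commutator_bracketEval_elimFamily_mem hg s₀ t
    exact h (Subgroup.commutator_mem_commutator hx (subset_thicken rfl))
  induction t with
  | ih1 s =>
    by_cases hs : s = s₀
    · exact Or.inl (by rw [hs])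
    · refine Or.inr (subset_thicken ⟨.of (⟨s, hs⟩, 0), ?_, rfl⟩)
      simp [treeWeight, elimWeight]
  | ih2 x y hx hy =>
    right
    rcases hx with rfl | hx
    · rcases hy with rfl | hy
      · change ⁅g s₀, g s₀⁆ ∈ _
        rw [commutatorElement_self]
        exact one_mem _
      · change ⁅g s₀, bracketEval g y⁆ ∈ bracketSpan _ _ (wt s₀ + treeWeight wt y)
        rw [← commutatorElement_inv, add_comm]
        exact inv_mem (key hy)
    · rcases hy with rfl | hy
      · exact key hx
      · exact commutator_bracketSpan_le hg' _ _ (Subgroup.commutator_mem_commutator hx hy)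

theorem bracketSpan_le_elim (s₀ : S) {n : ℕ} (hn : n ≠ wt s₀) :
    bracketSpan g wt n ≤ bracketSpan (elimFamily g s₀) (elimWeight wt s₀) n := by
  refine thicken_le ?_ weightSeries_le_thicken
  rintro _ ⟨t, rfl, rfl⟩
  rcases bracketEval_mem_bracketSpan_elim hg s₀ t with rfl | h
  · exact absurd rfl hn
  · exact h

end

/-- A genuine bracket has weight at least `2 * q`, so below that bound only single letters occur. -/
theorem bracketSpan_eq_of_lt {g : S → F} {wt : S → ℕ} {q n : ℕ} (hwt : ∀ s, q ≤ wt s)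
    (hn : n < 2 * q) : bracketSpan g wt n = thicken (g '' {s | wt s = n}) n := by
  unfold bracketSpan
  congr 1
  ext x
  constructor
  · rintro ⟨t, ht, rfl⟩
    cases t with
    | of s => exact ⟨s, ht, rfl⟩
    | mul x y =>
      have h1 := treeWeight_ge hwt x
      have h2 := treeWeight_ge hwt y
      rw [treeWeight] at ht
      omega
  · rintro ⟨s, hs, rfl⟩
    exact ⟨.of s, hs, rfl⟩

/-- The lower central factors are spanned by bracket arrangements in group generators. -/
theorem weightSeries_le_bracketSpan {g : S → F} (hg : Subgroup.closure (Set.range g) = ⊤) {n : ℕ}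
    (hn : 1 ≤ n) : weightSeries (⊤ : Subgroup F) n ≤ bracketSpan g (fun _ => 1) n := by
  have hmem (s : S) : g s ∈ weightSeries (⊤ : Subgroup F) 1 := Subgroup.mem_top _
  have h1 : ⊤ ≤ bracketSpan g (fun _ => 1) 1 := by
    rw [← hg, Subgroup.closure_le]
    rintro _ ⟨s, rfl⟩
    exact subset_thicken ⟨.of s, rfl, rfl⟩
  induction n, hn using Nat.le_induction with
  | base => exact h1
  | succ n hn ih =>
    obtain ⟨n, rfl⟩ := Nat.exists_eq_add_of_le' hn
    rw [weightSeries_succ_succ]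
    exact (Subgroup.commutator_mono ih h1).trans (commutator_bracketSpan_le hmem _ _)

end Span

/-! ### Elimination in free associative algebras: freeness -/

section FreeFamily

variable {k : Type*} [CommRing k] {S A B : Type*} [Ring A] [Algebra k A] [Ring B] [Algebra k B]

/-- A family freely generates a subalgebra. -/
def IsFreeFamily (k : Type*) [CommRing k] {S A : Type*} [Ring A] [Algebra k A] (a : S → A) : Prop :=
  Function.Injective (FreeAlgebra.lift k a)

theorem isFreeFamily_ι : IsFreeFamily k (FreeAlgebra.ι k : S → FreeAlgebra k S) := by
  have : FreeAlgebra.lift k (FreeAlgebra.ι k : S → FreeAlgebra k S) = AlgHom.id k _ := by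
    ext s; simp
  rw [IsFreeFamily, this]
  exact Function.injective_id

theorem map_iterBracket (f : A →ₐ[k] B) (a b : A) (n : ℕ) :
    f (iterBracket a b n) = iterBracket (f a) (f b) n := by
  induction n with
  | zero => rfl
  | succ n ih => simp [iterBracket, Ring.lie_def, ih]

/-- The algebra homomorphism to the dual numbers which corresponds to the derivation of a free
algebra with prescribed values on the generators. -/
noncomputable def dualHom (d : S → FreeAlgebra k S) :
    FreeAlgebra k S →ₐ[k] TrivSqZeroExt (FreeAlgebra k S) (FreeAlgebra k S) :=
  FreeAlgebra.lift k fun s => TrivSqZeroExt.inl (FreeAlgebra.ι k s) + TrivSqZeroExt.inr (d s)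

theorem fst_dualHom (d : S → FreeAlgebra k S) (x : FreeAlgebra k S) :
    (dualHom d x).fst = x := by
  have : (TrivSqZeroExt.fstHom k (FreeAlgebra k S) (FreeAlgebra k S)).comp (dualHom d)
      = AlgHom.id k _ := by
    ext s; simp [dualHom]
  exact DFunLike.congr_fun this x

/-- The derivation of a free algebra with prescribed values on the generators. -/
noncomputable def freeDerivation (d : S → FreeAlgebra k S) :
    FreeAlgebra k S →ₗ[k] FreeAlgebra k S where
  toFun x := (dualHom d x).snd
  map_add' x y := by simp
  map_smul' c x := by simp

theorem freeDerivation_ι (d : S → FreeAlgebra k S) (s : S) :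
    freeDerivation d (FreeAlgebra.ι k s) = d s := by
  simp [freeDerivation, dualHom]

theorem freeDerivation_mul (d : S → FreeAlgebra k S) (x y : FreeAlgebra k S) :
    freeDerivation d (x * y) = x * freeDerivation d y + freeDerivation d x * y := by
  simp [freeDerivation, fst_dualHom]

/-- Elimination of a free generator in a free algebra: the elements `[s, s₀, …, s₀]` with `s ≠ s₀`
are free generators of a subalgebra. The proof lets the free algebra on `S` act on the free algebra
on the new generators, `s₀` acting by a derivation. -/
theorem isFreeFamily_elim_ι (s₀ : S) :
    IsFreeFamily k (elimFamily (FreeAlgebra.ι k : S → FreeAlgebra k S) s₀) := by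
  classical
  let A' := FreeAlgebra k ({s // s ≠ s₀} × ℕ)
  -- For left multiplication L_x and a derivation D one has [L_x, D] = −L_{D x}; the minus sign here
  -- makes [L_{(s,n)}, D] equal to L_{(s,n+1)}.
  let D : Module.End k A' := freeDerivation fun s => -FreeAlgebra.ι k (s.1, s.2 + 1)
  let ρ : FreeAlgebra k S →ₐ[k] Module.End k A' := FreeAlgebra.lift k fun s =>
    if h : s = s₀ then D else LinearMap.mulLeft k (FreeAlgebra.ι k (⟨s, h⟩, 0))
  have hρ₀ : ρ (FreeAlgebra.ι k s₀) = D := by simp [ρ]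
  have hρ (s : {s // s ≠ s₀}) (n : ℕ) :
      ρ (iterBracket (FreeAlgebra.ι k s.1) (FreeAlgebra.ι k s₀) n)
        = LinearMap.mulLeft k (FreeAlgebra.ι k (s, n)) := by
    induction n with
    | zero => simp [iterBracket, ρ, s.2]
    | succ n ih =>
      rw [iterBracket, Ring.lie_def, map_sub, map_mul, map_mul, ih, hρ₀]
      ext v
      have h1 : D (FreeAlgebra.ι k (s, n) * v)
          = FreeAlgebra.ι k (s, n) * D v + D (FreeAlgebra.ι k (s, n)) * v :=
        freeDerivation_mul _ _ _
      have h2 : D (FreeAlgebra.ι k (s, n)) = -FreeAlgebra.ι k (s, n + 1) := freeDerivation_ι _ _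
      have h3 (x y : FreeAlgebra k ({s // s ≠ s₀} × ℕ)) : -(-x * y) = x * y := by
        rw [neg_mul, neg_neg]
      simp [h1, h2]
      exact h3 _ _
  have key : ρ.comp (FreeAlgebra.lift k (elimFamily (FreeAlgebra.ι k : S → _) s₀))
      = Algebra.lmul k A' := by
    ext s
    simp [elimFamily, hρ, A']
  intro x y hxy
  -- Evaluating the action at `1` gives a left inverse of the substitution homomorphism.
  have h (x : A') : ρ (FreeAlgebra.lift k (elimFamily (FreeAlgebra.ι k : S → _) s₀) x) 1 = x := by
    have := congrArg (fun f : Module.End k A' => f 1) (DFunLike.congr_fun key x)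
    simpa using this
  rw [← h x, hxy, h y]

theorem IsFreeFamily.elim {a : S → A} (ha : IsFreeFamily k a) (s₀ : S) :
    IsFreeFamily k (elimFamily a s₀) := by
  have : FreeAlgebra.lift k (elimFamily a s₀) = (FreeAlgebra.lift k a).comp
      (FreeAlgebra.lift k (elimFamily (FreeAlgebra.ι k : S → FreeAlgebra k S) s₀)) := by
    ext s
    simp [elimFamily, map_iterBracket]
  rw [IsFreeFamily, this]
  exact ha.comp (isFreeFamily_elim_ι s₀)

/-- In a free algebra the commutators `[u, v]` of generators, taken over a set of pairs which
contains at most one of `(u, v)` and `(v, u)`, are linearly independent. -/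
theorem IsFreeFamily.eq_zero_of_sum_bracket {a : S → A} (ha : IsFreeFamily k a) {I : Type*}
    [Fintype I] {u v : I → S} (h₁ : ∀ i j, u i = u j → v i = v j → i = j)
    (h₂ : ∀ i j, ¬ (v i = u j ∧ u i = v j)) {c : I → k}
    (hc : ∑ i, c i • ⁅a (u i), a (v i)⁆ = 0) (j : I) : c j = 0 := by
  classical
  have h0 : ∑ i, c i • ⁅FreeAlgebra.ι k (u i), FreeAlgebra.ι k (v i)⁆ = 0 := by
    apply ha
    simpa [map_sum, Ring.lie_def] using hc
  -- The upper right matrix entry reads off the coefficient of the word `u j · v j` among words of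
  -- length two.
  let φ : FreeAlgebra k S →ₐ[k] Matrix (Fin 3) (Fin 3) k := FreeAlgebra.lift k fun s =>
    !![0, if s = u j then 1 else 0, 0; 0, 0, if s = v j then 1 else 0; 0, 0, 0]
  have hφ (x y : S) : φ (FreeAlgebra.ι k x * FreeAlgebra.ι k y) 0 2
      = if x = u j ∧ y = v j then 1 else 0 := by
    simp only [φ, FreeAlgebra.lift_ι_apply, map_mul, Matrix.mul_apply, Fin.sum_univ_three]
    by_cases h1 : x = u j <;> by_cases h2 : y = v j <;> simp [h1, h2]
  have h1 := congrArg (fun x => φ x 0 2) h0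
  simp only [map_sum, map_smul, Ring.lie_def, map_sub, Matrix.sum_apply, Matrix.smul_apply,
    Matrix.sub_apply, hφ, map_zero, Matrix.zero_apply] at h1
  rw [Finset.sum_eq_single j] at h1
  · rw [if_pos ⟨rfl, rfl⟩, if_neg (h₂ j j)] at h1
    simpa using h1
  · intro i _ hij
    rw [if_neg (fun h => hij (h₁ i j h.1 h.2)), if_neg (h₂ i j)]
    simp
  · simp

end FreeFamily

/-! ### Generating functions and Witt's formula -/

section Counting

open PowerSeries

/-- The number of letters of weight `n` whose maximal letter is less than `i`. -/
noncomputable def letterCount {S : Type*} (wt mx : S → ℕ) (i n : ℕ) : ℕ :=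
  {s | wt s = n ∧ mx s < i}.ncard

/-- The inverse of the generating function for words by weight, in the letters with maximal letter
less than `i`. -/
noncomputable def alphabetSeries {S : Type*} (wt mx : S → ℕ) (i : ℕ) : ℚ⟦X⟧ :=
  1 - PowerSeries.mk fun n => (letterCount wt mx i n : ℚ)

/-- The maximal letters of the family obtained by eliminating `s₀`. -/
def elimMax {S : Type*} (mx : S → ℕ) (s₀ : S) : {s // s ≠ s₀} × ℕ → ℕ
  | (s, 0) => mx s
  | (s, _ + 1) => max (mx s) (mx s₀)

theorem elimMax_lt_iff {S : Type*} {mx : S → ℕ} {s₀ : S} {i : ℕ} (h : mx s₀ < i)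
    (x : {s // s ≠ s₀} × ℕ) : elimMax mx s₀ x < i ↔ mx x.1 < i := by
  rcases x with ⟨s, _ | j⟩ <;> simp [elimMax, h]

theorem finite_elimWeight_le {S : Type*} {wt : S → ℕ} (hfin : ∀ n, {s | wt s ≤ n}.Finite) (s₀ : S)
    (hs₀ : 1 ≤ wt s₀) (n : ℕ) : {x | elimWeight wt s₀ x ≤ n}.Finite := by
  have h1 : {s : {s // s ≠ s₀} | wt s ≤ n}.Finite :=
    (hfin n).preimage Subtype.val_injective.injOn
  refine (h1.prod (Set.finite_Iic n)).subset ?_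
  rintro ⟨s, j⟩ h
  simp only [Set.mem_ofPred_eq, elimWeight] at h
  refine ⟨(Nat.le_add_right _ _).trans h, ?_⟩
  exact (Nat.le_mul_of_pos_right j hs₀).trans ((Nat.le_add_left _ _).trans h)

theorem ncard_elim_base {S : Type*} (s₀ : S) (P : S → Prop) :
    ((fun s : {s // s ≠ s₀} => (s, 0)) '' {s | P s} : Set ({s // s ≠ s₀} × ℕ)).ncard
      = ({s | P s} \ {s₀}).ncard := by
  rw [Set.ncard_image_of_injective _ (fun a b h => (Prod.ext_iff.1 h).1),
    ← Set.ncard_image_of_injective _ Subtype.val_injective]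
  congr 1
  ext s
  simp [and_comm]

theorem letterCount_elim_of_le {S : Type*} {wt mx : S → ℕ} {s₀ : S} {i : ℕ} (h : i ≤ mx s₀)
    (n : ℕ) : letterCount (elimWeight wt s₀) (elimMax mx s₀) i n = letterCount wt mx i n := by
  have h1 : {x | elimWeight wt s₀ x = n ∧ elimMax mx s₀ x < i}
      = (fun s : {s // s ≠ s₀} => (s, 0)) '' {s | wt s = n ∧ mx s < i} := by
    ext ⟨s, j⟩
    rcases j with _ | j
    · simp [elimWeight, elimMax]
    · simp [elimMax, h]
  rw [letterCount, h1, ncard_elim_base s₀ (fun s => wt s = n ∧ mx s < i), letterCount,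
    Set.sdiff_singleton_eq_self]
  simp [h]

/-- A new letter is either an old one other than `s₀`, or a new letter bracketed once more with
`s₀`. With A, A′ the old and new counting series and w the weight of `s₀`, this says A′ + X^w = A +
X^w A′, that is, (1 − X^w)(1 − A′) = 1 − A. -/
theorem letterCount_elim_of_lt {S : Type*} {wt mx : S → ℕ} (hfin : ∀ n, {s | wt s ≤ n}.Finite)
    {s₀ : S} (hs₀ : 1 ≤ wt s₀) {i : ℕ} (h : mx s₀ < i) (n : ℕ) :
    letterCount (elimWeight wt s₀) (elimMax mx s₀) i n + (if n = wt s₀ then 1 else 0)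
      = letterCount wt mx i n +
        if wt s₀ ≤ n then letterCount (elimWeight wt s₀) (elimMax mx s₀) i (n - wt s₀) else 0 := by
  have hfin' := finite_elimWeight_le hfin s₀ hs₀
  have h1 : {x | elimWeight wt s₀ x = n ∧ elimMax mx s₀ x < i}
      = (fun s : {s // s ≠ s₀} => (s, 0)) '' {s | wt s = n ∧ mx s < i} ∪
        (fun x : {s // s ≠ s₀} × ℕ => (x.1, x.2 + 1)) ''
          {x | elimWeight wt s₀ x + wt s₀ = n ∧ elimMax mx s₀ x < i} := by
    ext ⟨s, j⟩
    rcases j with _ | j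
    · simp [elimWeight, elimMax]
    · simp [elimWeight, elimMax_lt_iff h, Nat.succ_mul, add_assoc]
  have h2 : {x | elimWeight wt s₀ x + wt s₀ = n ∧ elimMax mx s₀ x < i}.ncard =
      if wt s₀ ≤ n then letterCount (elimWeight wt s₀) (elimMax mx s₀) i (n - wt s₀) else 0 := by
    split_ifs with hn
    · rw [letterCount]
      congr 1
      ext x
      have : elimWeight wt s₀ x + wt s₀ = n ↔ elimWeight wt s₀ x = n - wt s₀ := by omega
      simp [this]
    · rw [Set.ncard_eq_zero ((hfin' n).subset fun x hx => by simp at hx ⊢; omega)]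
      ext x
      simp only [Set.mem_ofPred_eq, Set.mem_empty_iff_false, iff_false]
      omega
  have h3 : ({s | wt s = n ∧ mx s < i} \ {s₀}).ncard + (if n = wt s₀ then 1 else 0)
      = letterCount wt mx i n := by
    split_ifs with hn
    · exact Set.ncard_sdiff_singleton_add_one ⟨hn.symm, h⟩ ((hfin n).subset fun x hx => hx.1.le)
    · rw [Set.sdiff_singleton_eq_self (fun hx => hn hx.1.symm)]
      rfl
  have hf1 : ((fun s : {s // s ≠ s₀} => ((s, 0) : {s // s ≠ s₀} × ℕ)) ''
      {s | wt s = n ∧ mx s < i}).Finite :=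
    Set.Finite.image _ (((hfin n).preimage Subtype.val_injective.injOn).subset
      fun x hx => hx.1.le)
  have hf2 : ((fun x : {s // s ≠ s₀} × ℕ => (x.1, x.2 + 1)) ''
      {x | elimWeight wt s₀ x + wt s₀ = n ∧ elimMax mx s₀ x < i}).Finite := by
    refine Set.Finite.image _ ((hfin' n).subset fun x hx => ?_)
    have := hx.1
    simp only [Set.mem_ofPred_eq]
    omega
  rw [letterCount, h1, Set.ncard_union_eq ?_ hf1 hf2,
    ncard_elim_base s₀ (fun s => wt s = n ∧ mx s < i), Set.ncard_image_of_injective, h2, ← h3]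
  · ring
  · rintro ⟨a, b⟩ ⟨c, d⟩ hx
    simpa using hx
  · rw [Set.disjoint_left]
    rintro _ ⟨s, _, rfl⟩ ⟨x, _, hx⟩
    simp at hx

/-- The factor by which the elimination of a letter of weight `x.1` with maximal letter `x.2`
changes the alphabet series. -/
noncomputable def elimFactor (i : ℕ) (x : ℕ × ℕ) : ℚ⟦X⟧ :=
  if x.2 < i then 1 - (X : ℚ⟦X⟧) ^ x.1 else 1

theorem elimFactor_mul_alphabetSeries {S : Type*} {wt mx : S → ℕ}
    (hfin : ∀ n, {s | wt s ≤ n}.Finite) {s₀ : S} (hs₀ : 1 ≤ wt s₀) (i : ℕ) :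
    elimFactor i (wt s₀, mx s₀) * alphabetSeries (elimWeight wt s₀) (elimMax mx s₀) i
      = alphabetSeries wt mx i := by
  unfold elimFactor alphabetSeries
  dsimp only
  split_ifs with h
  · ext n
    have h1 := congrArg (Nat.cast (R := ℚ)) (letterCount_elim_of_lt hfin hs₀ h n)
    push_cast at h1
    rw [sub_mul, one_mul, map_sub, map_sub, map_sub, coeff_X_pow_mul', coeff_mk, coeff_mk, map_sub,
      coeff_mk, coeff_one, coeff_one]
    rcases lt_trichotomy n (wt s₀) with hn | hn | hn
    · rw [if_neg hn.ne, if_neg hn.not_ge] at h1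
      rw [if_neg hn.not_ge]
      linarith
    · rw [if_pos hn, if_pos hn.ge] at h1
      rw [if_pos hn.ge, if_neg (by omega : n ≠ 0), if_pos (by omega : n - wt s₀ = 0)]
      linarith
    · rw [if_neg hn.ne', if_pos hn.le] at h1
      rw [if_pos hn.le, if_neg (by omega : n - wt s₀ ≠ 0)]
      linarith
  · rw [one_mul]
    simp only [letterCount_elim_of_le (not_lt.1 h)]

/-- The logarithmic derivative of `elimFactor`. -/
noncomputable def elimLog (i : ℕ) (x : ℕ × ℕ) : ℚ⟦X⟧ :=
  PowerSeries.mk fun n => if x.2 < i ∧ n ≠ 0 ∧ x.1 ∣ n then (x.1 : ℚ) else 0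

/-- With w = `x.1`, this is the expansion w X^w / (1 − X^w) = ∑_{e ≥ 1} w X^{we}, multiplied out. -/
theorem X_mul_derivative_elimFactor (i : ℕ) {x : ℕ × ℕ} (hx : 1 ≤ x.1) :
    -(X * derivative ℚ (elimFactor i x)) = elimFactor i x * elimLog i x := by
  unfold elimFactor elimLog
  split_ifs with h
  · ext n
    rcases n with _ | n
    · simp
    · rw [sub_mul, one_mul, map_neg, coeff_succ_X_mul, coeff_derivative, map_sub, map_sub,
        coeff_X_pow_mul', coeff_one, coeff_X_pow, coeff_mk]
      simp only [h, true_and, coeff_mk]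
      rcases lt_trichotomy (n + 1) x.1 with hn | hn | hn
      · rw [if_neg hn.not_ge, if_neg (by omega), if_neg hn.ne,
          if_neg (fun h => hn.not_ge (Nat.le_of_dvd (by omega) h.2))]
        simp
      · rw [if_pos hn.ge, if_neg (by omega), if_pos hn, if_pos ⟨by omega, by rw [hn]⟩,
          if_neg (by omega)]
        rw [← hn]
        push_cast
        ring
      · rw [if_pos hn.le, if_neg (by omega), if_neg hn.ne']
        have h1 : x.1 ∣ n + 1 - x.1 ↔ x.1 ∣ n + 1 := 
          (Nat.dvd_sub_iff_left hn.le dvd_rfl)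
        have h2 : n + 1 - x.1 ≠ 0 := by omega
        simp [h1, h2]
  · ext n
    simp [h]

theorem X_mul_derivative_prod (i : ℕ) {l : List (ℕ × ℕ)} (hl : ∀ x ∈ l, 1 ≤ x.1) :
    -(X * derivative ℚ (l.map (elimFactor i)).prod)
      = (l.map (elimFactor i)).prod * (l.map (elimLog i)).sum := by
  induction l with
  | nil => simp
  | cons x l ih =>
    have h1 := ih fun y hy => hl y (List.mem_cons_of_mem _ hy)
    have h2 := X_mul_derivative_elimFactor i (hl x List.mem_cons_self)
    simp only [List.map_cons, List.prod_cons, List.sum_cons, Derivation.leibniz, smul_eq_mul]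
    linear_combination elimFactor i x * h1 + (l.map (elimFactor i)).prod * h2

theorem coeff_elimLog_sum (i : ℕ) (l : List (ℕ × ℕ)) {n : ℕ} (hn : n ≠ 0) :
    coeff n (l.map (elimLog i)).sum
      = ∑ d ∈ n.divisors, (d : ℚ) * (l.countP fun x => x.1 = d ∧ x.2 < i) := by
  induction l with
  | nil => simp
  | cons x l ih =>
    simp only [List.map_cons, List.sum_cons, map_add, ih, List.countP_cons, Nat.cast_add, mul_add,
      Finset.sum_add_distrib, elimLog, coeff_mk]
    rw [add_comm]
    congr 1
    by_cases h : x.2 < i <;> simp [h, hn, Nat.mem_divisors]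

theorem prod_elimFactor_ne_zero (i : ℕ) {l : List (ℕ × ℕ)} (hl : ∀ x ∈ l, 1 ≤ x.1) :
    (l.map (elimFactor i)).prod ≠ 0 := by
  refine List.prod_ne_zero fun h => ?_
  obtain ⟨x, hx, h0⟩ := List.mem_map.1 h
  have h1 := congrArg (coeff 0) h0
  have := hl x hx
  unfold elimFactor at h1
  split_ifs at h1
  · rw [map_sub, coeff_X_pow, if_neg (by omega)] at h1
    simp at h1
  · simp at h1

/-- Witt's formula for the number of letters which are left after all letters of weight less than
`q` have been eliminated. -/
theorem letterCount_eq_wittChi {S : Type*} {wt mx : S → ℕ} {q i : ℕ} {l : List (ℕ × ℕ)}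
    (hwt : ∀ s, q ≤ wt s) (hl : ∀ x ∈ l, 1 ≤ x.1 ∧ x.1 < q)
    (h : (l.map (elimFactor i)).prod * alphabetSeries wt mx i = 1 - (i : ℚ⟦X⟧) * X)
    {n : ℕ} (hn0 : 0 < n) (hqn : q ≤ n) (hn : n < 2 * q) :
    (letterCount wt mx i n : ℚ) = wittChi n i := by
  set f := alphabetSeries wt mx i with hf
  set P := (l.map (elimFactor i)).prod
  set T := (l.map (elimLog i)).sum
  have hP : P ≠ 0 := prod_elimFactor_ne_zero i fun x hx => (hl x hx).1
  have hA (n : ℕ) (hn : n < q) : letterCount wt mx i n = 0 := by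
    have : {s | wt s = n ∧ mx s < i} = ∅ := by
      ext s
      have := hwt s
      simp only [Set.mem_ofPred_eq, Set.mem_empty_iff_false, iff_false]
      omega
    rw [letterCount, this, Set.ncard_empty]
  -- This is iX / (1 − iX), the logarithmic derivative −X · d/dX log of 1 − iX.
  let T' : ℚ⟦X⟧ := PowerSeries.mk fun n => if n = 0 then 0 else (i : ℚ) ^ n
  have hT' : (1 - (i : ℚ⟦X⟧) * X) * T' = (i : ℚ⟦X⟧) * X := by
    have hC : (i : ℚ⟦X⟧) = C (i : ℚ) := by simp
    ext n
    rw [hC, sub_mul, one_mul, mul_assoc, map_sub, coeff_C_mul, coeff_C_mul]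
    rcases n with _ | n
    · simp [T']
    · rw [coeff_succ_X_mul, coeff_X]
      rcases n with _ | n
      · simp [T']
      · simp [T', pow_succ']
  -- The logarithmic derivative of P · f = 1 − iX is −X f′/f = T′ − T, here with denominators
  -- cleared.
  have h1 : P * (f * (T' - T)) = P * (-(X * derivative ℚ f)) := by
    have h2 := X_mul_derivative_prod i fun x hx => (hl x hx).1
    have h3 := congrArg (derivative ℚ) h
    simp only [Derivation.leibniz, smul_eq_mul, map_sub, Derivation.map_natCast,
      Derivation.map_one_eq_zero, derivative_X] at h3
    rw [← h] at hT'
    linear_combination hT' + X * h3 + f * h2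
  have h2 := mul_left_cancel₀ hP h1
  have hU (n : ℕ) : coeff n (T' - T) = ∑ p ∈ Finset.HasAntidiagonal.antidiagonal n,
      (letterCount wt mx i p.1 : ℚ) * coeff p.2 (T' - T) + n * letterCount wt mx i n := by
    have h3 := congrArg (coeff n) h2
    have h4 : coeff n (-(X * derivative ℚ f)) = n * (letterCount wt mx i n : ℚ) := by
      rcases n with _ | n
      · simp
      · rw [map_neg, coeff_succ_X_mul, coeff_derivative, hf, alphabetSeries, map_sub, coeff_mk,
          coeff_one, if_neg (by omega)]
        push_cast
        ring
    rw [h4, hf, alphabetSeries, sub_mul, one_mul, map_sub, coeff_mul] at h3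
    simp only [coeff_mk] at h3
    linarith
  have hU1 (n : ℕ) (hn : n < q) : coeff n (T' - T) = 0 := by
    rw [hU, hA n hn, Finset.sum_eq_zero]
    · simp
    · intro p hp
      rw [hA p.1 (by have := Finset.HasAntidiagonal.mem_antidiagonal.1 hp; omega)]
      simp
  -- No letter has weight below `q`, so f ≡ 1 modulo X^q and T′ − T starts in degree `q`; products
  -- of two such terms begin only in degree `2 * q`.
  have hU2 (n : ℕ) (hn : n < 2 * q) : coeff n (T' - T) = n * letterCount wt mx i n := by
    rw [hU, Finset.sum_eq_zero, zero_add]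
    intro p hp
    have := Finset.HasAntidiagonal.mem_antidiagonal.1 hp
    by_cases hp1 : p.1 < q
    · rw [hA _ hp1]
      simp
    · rw [hU1 p.2 (by omega), mul_zero]
  -- Eliminated and remaining letters are counted together; Möbius inversion applies to this total.
  let g (d : ℕ) : ℚ := d * ((l.countP fun x => x.1 = d ∧ x.2 < i : ℕ) + letterCount wt mx i d)
  have key : ∀ n > 0, n ∈ {n | n < 2 * q ∧ 0 < n} → ∑ d ∈ n.divisors, g d = (i : ℚ) ^ n := by
    rintro n hn0 ⟨hn, _⟩
    simp only [g, mul_add, Finset.sum_add_distrib]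
    rw [← coeff_elimLog_sum i l hn0.ne', Finset.sum_eq_single n, ← hU2 n hn]
    · simp [T', hn0.ne', T]
    -- A proper divisor of n < 2q is less than `q`, where no letters remain.
    · intro d hd hdn
      obtain ⟨e, rfl⟩ := (Nat.mem_divisors.1 hd).1
      have : d < q := by
        have : 2 ≤ e := by
          rcases e with _ | _ | e
          · simp at hn0
          · simp at hdn
          · omega
        nlinarith
      simp [hA d this]
    · simp [hn0.ne']
  have hclosed : ∀ m n : ℕ, m ∣ n → n ∈ {n | n < 2 * q ∧ 0 < n} → m ∈ {n | n < 2 * q ∧ 0 < n} :=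
    fun m n hmn hn' => ⟨(Nat.le_of_dvd hn'.2 hmn).trans_lt hn'.1, Nat.pos_of_dvd_of_pos hmn hn'.2⟩
  have hm := (ArithmeticFunction.sum_eq_iff_sum_mul_moebius_eq_on _ hclosed).1 key n hn0 ⟨hn, hn0⟩
  have hcount : (l.countP fun x => x.1 = n ∧ x.2 < i) = 0 := by
    rw [List.countP_eq_zero]
    intro x hx
    have := (hl x hx).2
    simp
    omega
  rw [Nat.sum_divisorsAntidiagonal (fun a b => (ArithmeticFunction.moebius a : ℚ) * (i : ℚ) ^ b)]
    at hm
  rw [wittChi, hm]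
  simp only [g, hcount]
  field_simp
  simp

end Counting

/-! ### Successive elimination of all letters of small weight -/

section HallSets

open PowerSeries

/-- The bracket of two bracket arrangements. -/
instance instBracketFreeMagma (X : Type*) : Bracket (FreeMagma X) (FreeMagma X) :=
  ⟨FreeMagma.mul⟩

/-- The number of leaves of a bracket arrangement. -/
def treeLength {X : Type*} (t : FreeMagma X) : ℕ :=
  treeWeight (fun _ => 1) t

/-- The maximal letter of a bracket arrangement. -/
def treeMax {m : ℕ} : FreeMagma (Fin m) → ℕ
  | .of i => i
  | .mul x y => max (treeMax x) (treeMax y)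

theorem treeMax_lt {m : ℕ} (t : FreeMagma (Fin m)) : treeMax t < m := by
  induction t with
  | ih1 i => exact i.2
  | ih2 x y hx hy => exact max_lt hx hy

theorem bracketEval_iterBracket {X A : Type*} [Bracket A A] (f : X → A) (s t : FreeMagma X)
    (j : ℕ) : bracketEval f (iterBracket s t j) =
      iterBracket (bracketEval f s) (bracketEval f t) j := by
  induction j with
  | zero => rfl
  | succ j ih => exact congrArg (⁅·, bracketEval f t⁆) ih

theorem bracketEval_elimFamily {X A S : Type*} [Bracket A A] (f : X → A) (tree : S → FreeMagma X)
    (s₀ : S) : (fun s => bracketEval f (elimFamily tree s₀ s)) =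
      elimFamily (fun s => bracketEval f (tree s)) s₀ :=
  funext fun _ => bracketEval_iterBracket _ _ _ _

theorem treeLength_elimFamily {X S : Type*} (tree : S → FreeMagma X) (s₀ : S) :
    (fun s => treeLength (elimFamily tree s₀ s)) =
      elimWeight (fun s => treeLength (tree s)) s₀ := by
  funext ⟨s, j⟩
  induction j with
  | zero => simp [elimFamily, elimWeight, iterBracket]
  | succ j ih =>
    change treeLength (elimFamily tree s₀ (s, j)) + treeLength (tree s₀) = _
    rw [ih]
    simp only [elimWeight]
    ring

theorem treeMax_elimFamily {m : ℕ} {S : Type*} (tree : S → FreeMagma (Fin m)) (s₀ : S) :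
    (fun s => treeMax (elimFamily tree s₀ s)) = elimMax (fun s => treeMax (tree s)) s₀ := by
  funext ⟨s, j⟩
  induction j with
  | zero => rfl
  | succ j ih =>
    change max (treeMax (elimFamily tree s₀ (s, j))) (treeMax (tree s₀)) = _
    rw [ih]
    rcases j with _ | j
    · rfl
    · simp [elimMax]

theorem treeLength_pos {X : Type*} (t : FreeMagma X) : 1 ≤ treeLength t :=
  treeWeight_ge (fun _ => le_rfl) t

/-- A family of bracket arrangements, obtained from the letters by eliminating a list of
arrangements (of which `l` records the lengths and maximal letters) of length less than `q`. -/
structure IsHallStage {m : ℕ} {S : Type} (tree : S → FreeMagma (Fin m)) (q : ℕ)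
    (l : List (ℕ × ℕ)) : Prop where
  finite : ∀ n, {s | treeLength (tree s) ≤ n}.Finite
  free : ∀ (k : Type) [CommRing k], IsFreeFamily k fun s => bracketEval (FreeAlgebra.ι k) (tree s)
  span : ∀ n, q ≤ n → weightSeries (⊤ : Subgroup (FreeGroup (Fin m))) n ≤
    bracketSpan (fun s => bracketEval FreeGroup.of (tree s)) (fun s => treeLength (tree s)) n
  eliminated : ∀ x ∈ l, 1 ≤ x.1 ∧ x.1 < q
  series : ∀ i ≤ m, (l.map (elimFactor i)).prod *
    alphabetSeries (fun s => treeLength (tree s)) (fun s => treeMax (tree s)) i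
      = 1 - (i : ℚ⟦X⟧) * X

theorem bracketEval_of_mem {X : Type*} (t : FreeMagma X) : bracketEval FreeGroup.of t ∈
    weightSeries (⊤ : Subgroup (FreeGroup X)) (treeLength t) :=
  bracketEval_mem_weightSeries (fun _ => Subgroup.mem_top _) t

theorem isHallStage_of (m : ℕ) : IsHallStage (FreeMagma.of : Fin m → FreeMagma (Fin m)) 1 [] where
  finite n := Set.toFinite _
  free k _ := isFreeFamily_ι
  span n hn := weightSeries_le_bracketSpan (FreeGroup.closure_range_of _) hn
  eliminated x hx := by simp at hx
  series i hi := by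
    have h1 (n : ℕ) : letterCount (fun s : Fin m => treeLength (FreeMagma.of s))
        (fun s => treeMax (FreeMagma.of s)) i n = if n = 1 then i else 0 := by
      change {s : Fin m | 1 = n ∧ (s : ℕ) < i}.ncard = _
      split_ifs with hn
      · have : {s : Fin m | 1 = n ∧ (s : ℕ) < i} = Set.range (Fin.castLE hi) := by
          ext s
          simp only [hn, true_and, Set.mem_ofPred_eq, Set.mem_range]
          exact ⟨fun h => ⟨⟨s, h⟩, rfl⟩, by rintro ⟨a, rfl⟩; exact a.2⟩
        rw [this, ← Set.image_univ, Set.ncard_image_of_injective _ (Fin.castLE_injective hi),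
          Set.ncard_univ, Nat.card_fin]
      · have : {s : Fin m | 1 = n ∧ (s : ℕ) < i} = ∅ := by
          ext s
          simp [Ne.symm hn]
        rw [this, Set.ncard_empty]
    have hC : (i : ℚ⟦X⟧) = C (i : ℚ) := by simp
    ext n
    simp only [List.map_nil, List.prod_nil, one_mul, alphabetSeries, h1, hC, map_sub, coeff_C_mul,
      coeff_X, coeff_mk]
    split_ifs <;> simp

theorem IsHallStage.mono {m : ℕ} {S : Type} {tree : S → FreeMagma (Fin m)} {q q' : ℕ}
    {l : List (ℕ × ℕ)} (h : IsHallStage tree q l) (hq : q ≤ q') : IsHallStage tree q' l where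
  finite := h.finite
  free := h.free
  span n hn := h.span n (hq.trans hn)
  eliminated x hx := ⟨(h.eliminated x hx).1, (h.eliminated x hx).2.trans_le hq⟩
  series := h.series

theorem IsHallStage.elim {m : ℕ} {S : Type} {tree : S → FreeMagma (Fin m)} {q : ℕ}
    {l : List (ℕ × ℕ)} (h : IsHallStage tree q l) {s₀ : S} (hs₀ : treeLength (tree s₀) < q) :
    IsHallStage (elimFamily tree s₀) q ((treeLength (tree s₀), treeMax (tree s₀)) :: l) where
  finite n := by
    have := finite_elimWeight_le h.finite s₀ (treeLength_pos _) n
    rwa [← treeLength_elimFamily] at this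
  free k _ := by
    rw [bracketEval_elimFamily]
    exact (h.free k).elim s₀
  span n hn := by
    rw [bracketEval_elimFamily, treeLength_elimFamily]
    exact (h.span n hn).trans
      (bracketSpan_le_elim (fun s => bracketEval_of_mem (tree s)) s₀ (hs₀.trans_le hn).ne')
  eliminated x hx := by
    rcases List.mem_cons.1 hx with rfl | hx
    · exact ⟨treeLength_pos _, hs₀⟩
    · exact h.eliminated x hx
  series i hi := by
    rw [treeLength_elimFamily, treeMax_elimFamily, List.map_cons, List.prod_cons, mul_right_comm,
      elimFactor_mul_alphabetSeries (mx := fun s => treeMax (tree s)) h.finite (treeLength_pos _),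
      mul_comm]
    exact h.series i hi

theorem exists_isHallStage_succ {m q : ℕ} (hq : 1 ≤ q) (r : ℕ) {S : Type}
    {tree : S → FreeMagma (Fin m)} {l : List (ℕ × ℕ)} (h : IsHallStage tree (q + 1) l)
    (hwt : ∀ s, q ≤ treeLength (tree s)) (hr : {s | treeLength (tree s) = q}.ncard = r) :
    ∃ (S : Type) (tree : S → FreeMagma (Fin m)) (l : List (ℕ × ℕ)), IsHallStage tree (q + 1) l ∧
      ∀ s, q + 1 ≤ treeLength (tree s) := by
  have hfin : {s | treeLength (tree s) = q}.Finite := (h.finite q).subset fun s hs => hs.le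
  induction r generalizing S l with
  | zero =>
    refine ⟨S, tree, l, h, fun s => (hwt s).lt_of_ne' fun hs => ?_⟩
    rw [Set.ncard_eq_zero hfin] at hr
    exact Set.notMem_empty s (hr ▸ hs)
  | succ r ih =>
    obtain ⟨s₀, hs₁⟩ : {s | treeLength (tree s) = q}.Nonempty := by
      rw [← Set.ncard_pos hfin, hr]
      omega
    have hs₀ : treeLength (tree s₀) = q := hs₁
    have hlen (x) : treeLength (elimFamily tree s₀ x) = treeLength (tree x.1) + x.2 * q := by
      rw [← hs₀]
      exact congrFun (treeLength_elimFamily tree s₀) x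
    have h' := h.elim (s₀ := s₀) (by omega)
    refine ih h' (fun x => ?_) ?_ ((h'.finite q).subset fun s hs => hs.le)
    · rw [hlen]
      exact (hwt _).trans (Nat.le_add_right _ _)
    -- Letters `(s, j)` with `j ≥ 1` have weight at least `2 * q`, so the weight-`q` letters are the
    -- old ones without `s₀`.
    · have : {x | treeLength (elimFamily tree s₀ x) = q}
          = (fun s : {s // s ≠ s₀} => (s, 0)) '' {s | treeLength (tree s) = q} := by
        ext ⟨s, j⟩
        have := hwt s
        rcases j with _ | j
        · simp [hlen]
        · simp only [hlen, Set.mem_ofPred_eq, Set.mem_image, Prod.mk.injEq, Nat.succ_ne_zero,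
            right_eq_add, and_false, exists_false, iff_false, Nat.succ_mul]
          omega
      rw [this, ncard_elim_base s₀ fun s => treeLength (tree s) = q,
        Set.ncard_sdiff_singleton_of_mem hs₁, hr]
      rfl

theorem exists_isHallStage (m : ℕ) {q : ℕ} (hq : 1 ≤ q) :
    ∃ (S : Type) (tree : S → FreeMagma (Fin m)) (l : List (ℕ × ℕ)), IsHallStage tree q l ∧
      ∀ s, q ≤ treeLength (tree s) := by
  induction q, hq using Nat.le_induction with
  | base => exact ⟨_, _, _, isHallStage_of m, fun s => treeLength_pos _⟩
  | succ q hq ih =>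
    obtain ⟨S, tree, l, h, hwt⟩ := ih
    exact exists_isHallStage_succ hq _ (h.mono q.le_succ) hwt rfl

/-- The number of arrangements of length `n` in the first `i` letters. -/
noncomputable def treeCount {m : ℕ} {S : Type} (tree : S → FreeMagma (Fin m)) (i n : ℕ) : ℕ :=
  letterCount (fun s => treeLength (tree s)) (fun s => treeMax (tree s)) i n

theorem IsHallStage.treeCount_eq {m : ℕ} {S : Type} {tree : S → FreeMagma (Fin m)} {q : ℕ}
    {l : List (ℕ × ℕ)} (h : IsHallStage tree q l) (hwt : ∀ s, q ≤ treeLength (tree s)) {i n : ℕ}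
    (hi : i ≤ m) (hn0 : 0 < n) (hqn : q ≤ n) (hn : n < 2 * q) :
    (treeCount tree i n : ℚ) = wittChi n i :=
  letterCount_eq_wittChi hwt h.eliminated (h.series i hi) hn0 hqn hn

/-- Within one alphabet built from `i + 1` letters, the arrangements in the first `i` letters form a
subset of all arrangements. Both integrality and monotonicity of Witt's function come from this
count. -/
theorem exists_monotone_eq_wittChi {n : ℕ} (hn : 1 ≤ n) :
    ∃ w : ℕ → ℕ, Monotone w ∧ ∀ i : ℕ, (w i : ℚ) = wittChi n i := by
  have key (i : ℕ) : ∃ a b : ℕ, a ≤ b ∧ (a : ℚ) = wittChi n i ∧ (b : ℚ) = wittChi n (i + 1 : ℕ) := by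
    obtain ⟨S, tree, l, h, hwt⟩ := exists_isHallStage (i + 1) hn
    refine ⟨_, _, ?_, h.treeCount_eq hwt i.le_succ hn le_rfl (by omega),
      h.treeCount_eq hwt le_rfl hn le_rfl (by omega)⟩
    refine Set.ncard_le_ncard (fun s hs => ⟨hs.1, hs.2.trans i.lt_succ_self⟩) ?_
    exact (h.finite n).subset fun s hs => hs.1.le
  choose a b hab ha hb using key
  refine ⟨a, monotone_nat_of_le_succ fun i => ?_, ha⟩
  have : (a (i + 1) : ℚ) = b i := by rw [ha, hb]
  rw [Nat.cast_inj] at this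
  rw [this]
  exact hab i

end HallSets

/-! ### The Magnus expansion and its leading coefficients -/

section Magnus

open PowerSeries

variable {A : Type*} [Ring A]

theorem coeff_zero_mul (φ ψ : A⟦X⟧) : coeff 0 (φ * ψ) = coeff 0 φ * coeff 0 ψ := by
  simp

/-- The group of the power series which are congruent to `1` modulo `X ^ n`. -/
def congruenceSubgroup (A : Type*) [Ring A] (n : ℕ) : Subgroup (A⟦X⟧ˣ) where
  carrier := {u | (X : A⟦X⟧) ^ n ∣ u - 1}
  one_mem' := by simp
  mul_mem' {u v} hu hv := by
    have h : ((u * v : A⟦X⟧ˣ) : A⟦X⟧) - 1 = (u - 1) * v + (v - 1) := by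
      push_cast
      noncomm_ring
    simp only [Set.mem_ofPred_eq, h]
    exact dvd_add (hu.mul_right _) hv
  inv_mem' {u} hu := by
    have h : ((u⁻¹ : A⟦X⟧ˣ) : A⟦X⟧) - 1 = -(u - 1) * (u⁻¹ : A⟦X⟧ˣ) := by
      rw [neg_sub, sub_mul, one_mul, Units.mul_inv]
    simp only [Set.mem_ofPred_eq, h]
    exact ((dvd_neg).2 hu).mul_right _

theorem mem_congruenceSubgroup {n : ℕ} {u : A⟦X⟧ˣ} :
    u ∈ congruenceSubgroup A n ↔ ∃ a : A⟦X⟧, (u : A⟦X⟧) = 1 + X ^ n * a := by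
  constructor
  · rintro ⟨a, ha⟩
    exact ⟨a, by rw [← ha]; abel⟩
  · rintro ⟨a, ha⟩
    exact ⟨a, by rw [ha]; abel⟩

theorem coeff_one_add_X_pow_mul {n : ℕ} (hn : 1 ≤ n) (a : A⟦X⟧) :
    coeff n (1 + X ^ n * a) = coeff 0 a := by
  have := coeff_X_pow_mul a n 0
  rw [zero_add] at this
  rw [map_add, this, coeff_one, if_neg (by omega), zero_add]

theorem coeff_zero_of_mem_congruenceSubgroup {n : ℕ} (hn : 1 ≤ n) {u : A⟦X⟧ˣ}
    (hu : u ∈ congruenceSubgroup A n) : coeff 0 (u : A⟦X⟧) = 1 := by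
  obtain ⟨a, ha⟩ := mem_congruenceSubgroup.1 hu
  rw [ha, map_add, coeff_X_pow_mul', if_neg (by omega)]
  simp

theorem coeff_mul_of_mem_congruenceSubgroup {n : ℕ} (hn : 1 ≤ n) {u v : A⟦X⟧ˣ}
    (hu : u ∈ congruenceSubgroup A n) (hv : v ∈ congruenceSubgroup A n) :
    coeff n ((u * v : A⟦X⟧ˣ) : A⟦X⟧) = coeff n (u : A⟦X⟧) + coeff n (v : A⟦X⟧) := by
  obtain ⟨a, ha⟩ := mem_congruenceSubgroup.1 hu
  obtain ⟨b, hb⟩ := mem_congruenceSubgroup.1 hv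
  have h : ((u * v : A⟦X⟧ˣ) : A⟦X⟧) = 1 + X ^ n * (a * (v : A⟦X⟧) + b) := by
    rw [Units.val_mul, ha, add_mul, one_mul, mul_add, hb, mul_assoc]
    abel
  rw [h, ha, hb, coeff_one_add_X_pow_mul hn, coeff_one_add_X_pow_mul hn,
    coeff_one_add_X_pow_mul hn, map_add, ← hb, coeff_zero_mul,
    coeff_zero_of_mem_congruenceSubgroup hn hv, mul_one]

/-- As X is central, uv = vu + X^{m+n}(ab − ba); multiply by (vu)⁻¹ on the right. -/
theorem commutatorElement_val_eq {m n : ℕ} {u v : A⟦X⟧ˣ} {a b : A⟦X⟧}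
    (ha : (u : A⟦X⟧) = 1 + X ^ m * a) (hb : (v : A⟦X⟧) = 1 + X ^ n * b) :
    ((⁅u, v⁆ : A⟦X⟧ˣ) : A⟦X⟧)
      = 1 + X ^ (m + n) * ((a * b - b * a) * (((v * u)⁻¹ : A⟦X⟧ˣ) : A⟦X⟧)) := by
  have h1 : (u : A⟦X⟧) * (v : A⟦X⟧) = (v : A⟦X⟧) * (u : A⟦X⟧) + X ^ (m + n) * (a * b - b * a) := by
    have h2 : X ^ m * a * (X ^ n * b) = X ^ (m + n) * (a * b) := by
      rw [mul_assoc, ← mul_assoc a, ← X_pow_mul (φ := a) (n := n), pow_add]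
      simp only [mul_assoc]
    have h3 : X ^ n * b * (X ^ m * a) = X ^ (m + n) * (b * a) := by
      rw [mul_assoc, ← mul_assoc b, ← X_pow_mul (φ := b) (n := m), add_comm m n, pow_add]
      simp only [mul_assoc]
    simp only [ha, hb, mul_add, add_mul, mul_sub, mul_one, one_mul, h2, h3]
    abel
  have h4 : ⁅u, v⁆ = u * v * (v * u)⁻¹ := by simp [commutatorElement_def, mul_assoc]
  rw [h4, Units.val_mul, Units.val_mul u v, h1, add_mul, ← Units.val_mul, Units.mul_inv, mul_assoc]

theorem commutatorElement_mem_congruenceSubgroup {m n : ℕ} {u v : A⟦X⟧ˣ}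
    (hu : u ∈ congruenceSubgroup A m) (hv : v ∈ congruenceSubgroup A n) :
    ⁅u, v⁆ ∈ congruenceSubgroup A (m + n) := by
  obtain ⟨a, ha⟩ := mem_congruenceSubgroup.1 hu
  obtain ⟨b, hb⟩ := mem_congruenceSubgroup.1 hv
  exact mem_congruenceSubgroup.2 ⟨_, commutatorElement_val_eq ha hb⟩

theorem coeff_commutatorElement {m n : ℕ} (hm : 1 ≤ m) (hn : 1 ≤ n) {u v : A⟦X⟧ˣ}
    (hu : u ∈ congruenceSubgroup A m) (hv : v ∈ congruenceSubgroup A n) :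
    coeff (m + n) ((⁅u, v⁆ : A⟦X⟧ˣ) : A⟦X⟧) = ⁅coeff m (u : A⟦X⟧), coeff n (v : A⟦X⟧)⁆ := by
  obtain ⟨a, ha⟩ := mem_congruenceSubgroup.1 hu
  obtain ⟨b, hb⟩ := mem_congruenceSubgroup.1 hv
  have h : coeff 0 (((v * u)⁻¹ : A⟦X⟧ˣ) : A⟦X⟧) = 1 := by
    have h1 := congrArg (coeff 0) (Units.mul_inv (v * u))
    rwa [coeff_zero_mul, Units.val_mul, coeff_zero_mul,
      coeff_zero_of_mem_congruenceSubgroup hm hu, coeff_zero_of_mem_congruenceSubgroup hn hv,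
      one_mul, one_mul, coeff_zero_one] at h1
  rw [commutatorElement_val_eq ha hb, ha, hb, coeff_one_add_X_pow_mul (by omega),
    coeff_one_add_X_pow_mul hm, coeff_one_add_X_pow_mul hn, coeff_zero_mul, h, mul_one,
    Ring.lie_def, map_sub, coeff_zero_mul, coeff_zero_mul]

/-- The unit `1 + aX`. -/
noncomputable def oneAddUnit (a : A) : A⟦X⟧ˣ :=
  (isUnit_iff_constantCoeff.2 (by simp) : IsUnit (1 + X * C a : A⟦X⟧)).unit

theorem oneAddUnit_val (a : A) : (oneAddUnit a : A⟦X⟧) = 1 + X * C a := rfl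

variable {ι : Type*} (r : ι → A)

/-- The Magnus homomorphism, which sends the generator `i` to `1 + (r i) X`. -/
noncomputable def magnus : FreeGroup ι →* A⟦X⟧ˣ :=
  FreeGroup.lift fun i => oneAddUnit (r i)

/-- The coefficient of `X ^ n` in the Magnus expansion. -/
noncomputable def magnusCoeff (n : ℕ) (g : FreeGroup ι) : A :=
  coeff n (magnus r g : A⟦X⟧)

theorem magnus_mem_one (g : FreeGroup ι) : magnus r g ∈ congruenceSubgroup A 1 := by
  induction g using FreeGroup.induction_on with
  | C1 => rw [map_one]; exact one_mem _
  | of i =>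
    rw [mem_congruenceSubgroup]
    exact ⟨C (r i), by simp [magnus, oneAddUnit_val]⟩
  | inv_of i h => rw [map_inv]; exact inv_mem h
  | mul x y hx hy => rw [map_mul]; exact mul_mem hx hy

theorem magnus_mem {n : ℕ} (hn : 1 ≤ n) {g : FreeGroup ι}
    (hg : g ∈ weightSeries (⊤ : Subgroup (FreeGroup ι)) n) :
    magnus r g ∈ congruenceSubgroup A n := by
  have key : weightSeries (⊤ : Subgroup (FreeGroup ι)) n
      ≤ (congruenceSubgroup A n).comap (magnus r) := by
    clear hg
    induction n, hn using Nat.le_induction with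
    | base => exact fun g _ => magnus_mem_one r g
    | succ n hn ih =>
      obtain ⟨n, rfl⟩ := Nat.exists_eq_add_of_le' hn
      rw [weightSeries_succ_succ, Subgroup.commutator_le]
      intro x hx y _
      rw [Subgroup.mem_comap, map_commutatorElement]
      exact commutatorElement_mem_congruenceSubgroup (ih hx) (magnus_mem_one r y)
  exact key hg

theorem magnusCoeff_mul {n : ℕ} (hn : 1 ≤ n) {x y : FreeGroup ι}
    (hx : x ∈ weightSeries (⊤ : Subgroup (FreeGroup ι)) n)
    (hy : y ∈ weightSeries (⊤ : Subgroup (FreeGroup ι)) n) :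
    magnusCoeff r n (x * y) = magnusCoeff r n x + magnusCoeff r n y := by
  rw [magnusCoeff, map_mul]
  exact coeff_mul_of_mem_congruenceSubgroup hn (magnus_mem r hn hx) (magnus_mem r hn hy)

theorem magnusCoeff_commutatorElement {m n : ℕ} (hm : 1 ≤ m) (hn : 1 ≤ n) {x y : FreeGroup ι}
    (hx : x ∈ weightSeries (⊤ : Subgroup (FreeGroup ι)) m)
    (hy : y ∈ weightSeries (⊤ : Subgroup (FreeGroup ι)) n) :
    magnusCoeff r (m + n) ⁅x, y⁆ = ⁅magnusCoeff r m x, magnusCoeff r n y⁆ := by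
  rw [magnusCoeff, map_commutatorElement]
  exact coeff_commutatorElement hm hn (magnus_mem r hm hx) (magnus_mem r hn hy)

theorem magnusCoeff_of (i : ι) : magnusCoeff r 1 (FreeGroup.of i) = r i := by
  have := coeff_succ_X_mul 0 (C (r i))
  simp only [zero_add] at this
  rw [magnusCoeff, magnus, FreeGroup.lift_apply_of, oneAddUnit_val, map_add, this]
  simp [coeff_one]

/-- The leading coefficient of the Magnus expansion, as a homomorphism on a term of the lower
central series. -/
noncomputable def magnusHom {n : ℕ} (hn : 1 ≤ n) :
    weightSeries (⊤ : Subgroup (FreeGroup ι)) n →* Multiplicative A :=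
  MonoidHom.mk' (fun x => Multiplicative.ofAdd (magnusCoeff r n x))
    fun x y => magnusCoeff_mul r hn x.2 y.2

theorem magnusCoeff_bracketEval (t : FreeMagma ι) :
    magnusCoeff r (treeLength t) (bracketEval FreeGroup.of t) = bracketEval r t := by
  induction t with
  | ih1 i => exact magnusCoeff_of r i
  | ih2 x y hx hy =>
    exact (magnusCoeff_commutatorElement r (treeLength_pos x) (treeLength_pos y)
      (bracketEval_of_mem x) (bracketEval_of_mem y)).trans (by rw [hx, hy]; rfl)

/-- The exponent sum of the generator `i`. -/
def exponentSum {ι : Type*} [DecidableEq ι] (i : ι) : FreeGroup ι →* Multiplicative ℤ :=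
  FreeGroup.lift fun j => Multiplicative.ofAdd (if j = i then 1 else 0)

/-- The linear coefficient is a homomorphism to an abelian group, so it sees only exponent sums. -/
theorem magnusCoeff_one_eq_sum [Fintype ι] [DecidableEq ι] (g : FreeGroup ι) :
    magnusCoeff r 1 g = ∑ i, (exponentSum i g).toAdd • r i := by
  let φ : FreeGroup ι →* Multiplicative A :=
    MonoidHom.mk' (fun x => Multiplicative.ofAdd (magnusCoeff r 1 x))
      fun x y => magnusCoeff_mul r le_rfl (Subgroup.mem_top x) (Subgroup.mem_top y)
  let ψ : FreeGroup ι →* Multiplicative A :=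
    MonoidHom.mk' (fun x => Multiplicative.ofAdd (∑ i, (exponentSum i x).toAdd • r i))
      fun x y => by simp [add_smul, Finset.sum_add_distrib]
  have : φ = ψ := by
    ext j
    change Multiplicative.ofAdd (magnusCoeff r 1 (FreeGroup.of j)) = _
    rw [magnusCoeff_of]
    change r j = ∑ i, (exponentSum i (FreeGroup.of j)).toAdd • r i
    simp [exponentSum]
  exact DFunLike.congr_fun this g

end Magnus

/-! ### Verbal and marginal subgroups of the law -/

section Laws

/-- The left-normed bracket `[f s, f (s + 1), …, f (s + c)]`. -/
def leftNormed {A : Type*} [Bracket A A] (f : ℕ → A) (s : ℕ) : ℕ → A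
  | 0 => f s
  | c + 1 => ⁅leftNormed f s c, f (s + c + 1)⁆

theorem leftNormed_congr {A : Type*} [Bracket A A] {f f' : ℕ → A} {s c : ℕ}
    (h : ∀ j, s ≤ j → j ≤ s + c → f j = f' j) : leftNormed f s c = leftNormed f' s c := by
  induction c with
  | zero => exact h s le_rfl le_rfl
  | succ c ih =>
    rw [leftNormed, leftNormed, ih fun j h1 h2 => h j h1 (by omega), h _ (by omega) (by omega)]

variable {F : Type*} [Group F]

theorem leftNormed_eq_one {f : ℕ → F} {s : ℕ} (h : f s = 1) (c : ℕ) : leftNormed f s c = 1 := by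
  induction c with
  | zero => exact h
  | succ c ih => rw [leftNormed, ih, commutatorElement_one_left]

theorem lift_nilpotentWord (f : ℕ → F) (s c : ℕ) :
    FreeGroup.lift f (nilpotentWord s c) = leftNormed f s c := by
  induction c with
  | zero => simp [nilpotentWord, leftNormed]
  | succ c ih => simp [nilpotentWord, leftNormed, ih]

theorem conj_leftNormed (g : F) (f : ℕ → F) (s c : ℕ) :
    leftNormed (fun j => g * f j * g⁻¹) s c = g * leftNormed f s c * g⁻¹ := by
  rw [← lift_nilpotentWord, lift_conj_apply, lift_nilpotentWord]

theorem leftNormed_mem_weightSeries (f : ℕ → F) (s c : ℕ) :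
    leftNormed f s c ∈ weightSeries (⊤ : Subgroup F) (c + 1) := by
  induction c with
  | zero => exact Subgroup.mem_top _
  | succ c ih =>
    rw [weightSeries_succ_succ]
    exact Subgroup.commutator_mem_commutator ih (Subgroup.mem_top _)

theorem closure_normal_of_conj {C : Set F} (h : ∀ c ∈ C, ∀ g : F, g * c * g⁻¹ ∈ C) :
    (Subgroup.closure C).Normal := by
  constructor
  intro x hx g
  have hle : Subgroup.closure C ≤ (Subgroup.closure C).comap (MulAut.conj g).toMonoidHom := by
    rw [Subgroup.closure_le]
    exact fun c hc => Subgroup.subset_closure (h c hc g)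
  simpa using hle hx

/-- The set of left-normed commutators with first entry in `R` is stable under conjugation, so the
subgroup it generates is normal and the induction on `c` can be checked on generators. -/
theorem weightSeries_le_closure_leftNormed (R : Subgroup F) [hR : R.Normal] (s c : ℕ) :
    weightSeries R (c + 1) ≤ Subgroup.closure {x | ∃ f : ℕ → F, f s ∈ R ∧ leftNormed f s c = x} := by
  induction c with
  | zero => exact fun r hr => Subgroup.subset_closure ⟨fun _ => r, hr, rfl⟩
  | succ c ih =>
    have hN : (Subgroup.closure {x | ∃ f : ℕ → F, f s ∈ R ∧ leftNormed f s (c + 1) = x}).Normal := by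
      refine closure_normal_of_conj ?_
      rintro _ ⟨f, hf, rfl⟩ g
      exact ⟨fun j => g * f j * g⁻¹, hR.conj_mem _ hf g, conj_leftNormed g f s (c + 1)⟩
    rw [weightSeries_succ_succ]
    refine (Subgroup.commutator_mono ih (Subgroup.closure_univ (G := F)).ge).trans
      (commutator_closure_le ?_)
    rintro _ ⟨f, hf, rfl⟩ g _
    refine Subgroup.subset_closure ⟨Function.update f (s + c + 1) g, ?_, ?_⟩
    · rwa [Function.update_of_ne (by omega)]
    · rw [leftNormed, Function.update_self]
      congr 1
      exact leftNormed_congr fun j _ hj => Function.update_of_ne (by omega) _ _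

theorem lift_outerNilpotentLaw (f : ℕ → F) (c₁ c₂ : ℕ) :
    FreeGroup.lift f ⁅nilpotentWord 0 c₁, nilpotentWord (c₁ + 1) c₂⁆
      = ⁅leftNormed f 0 c₁, leftNormed f (c₁ + 1) c₂⁆ := by
  rw [map_commutatorElement, lift_nilpotentWord, lift_nilpotentWord]

theorem verbalSubgroup_normal (V : Set (FreeGroup ℕ)) : (verbalSubgroup V F).Normal := by
  refine closure_normal_of_conj ?_
  rintro _ ⟨v, hv, f, rfl⟩ g
  exact ⟨v, hv, fun j => g * f j * g⁻¹, (lift_conj_apply g f v).symm⟩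

theorem verbalSubgroup_outerNilpotentLaws (c₁ c₂ : ℕ) :
    verbalSubgroup (outerNilpotentLaws c₁ c₂) F =
      ⁅weightSeries (⊤ : Subgroup F) (c₁ + 1), weightSeries (⊤ : Subgroup F) (c₂ + 1)⁆ := by
  apply le_antisymm
  · unfold verbalSubgroup
    rw [Subgroup.closure_le]
    rintro _ ⟨_, rfl, f, rfl⟩
    rw [lift_outerNilpotentLaw]
    exact Subgroup.commutator_mem_commutator (leftNormed_mem_weightSeries f 0 c₁)
      (leftNormed_mem_weightSeries f (c₁ + 1) c₂)
  · have := verbalSubgroup_normal (F := F) (outerNilpotentLaws c₁ c₂)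
    refine (Subgroup.commutator_mono (weightSeries_le_closure_leftNormed ⊤ 0 c₁)
      (weightSeries_le_closure_leftNormed ⊤ (c₁ + 1) c₂)).trans (commutator_closure_le ?_)
    rintro _ ⟨f, -, rfl⟩ _ ⟨f', -, rfl⟩
    refine Subgroup.subset_closure ⟨_, rfl, fun j => if j ≤ c₁ then f j else f' j, ?_⟩
    rw [lift_outerNilpotentLaw]
    congr 1
    · exact leftNormed_congr fun j _ hj => (if_pos (by omega)).symm
    · exact leftNormed_congr fun j hj _ => (if_neg (by omega)).symm

variable (R : Subgroup F) [R.Normal]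

theorem commutator_left_le_marginalCommutator (c₁ c₂ : ℕ) :
    ⁅weightSeries R (c₁ + 1), weightSeries (⊤ : Subgroup F) (c₂ + 1)⁆ ≤
      marginalCommutator (outerNilpotentLaws c₁ c₂) R := by
  refine (Subgroup.commutator_mono (weightSeries_le_closure_leftNormed R 0 c₁)
    (weightSeries_le_closure_leftNormed ⊤ (c₁ + 1) c₂)).trans (commutator_closure_le ?_)
  rintro _ ⟨f, hf, rfl⟩ _ ⟨f', -, rfl⟩
  -- With `1` in the first variable the law takes the value 1, so altering that variable by `f 0 ∈
  -- R` yields exactly the desired commutator.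
  let h (j : ℕ) : F := if j = 0 then 1 else if j ≤ c₁ then f j else f' j
  refine Subgroup.subset_closure ⟨_, rfl, h, 0, f 0, hf, ?_⟩
  rw [lift_outerNilpotentLaw, lift_outerNilpotentLaw, leftNormed_eq_one (f := h) (by simp [h]),
    commutatorElement_one_left, inv_one, mul_one]
  congr 1
  · refine leftNormed_congr fun j _ hj => ?_
    rcases eq_or_ne j 0 with rfl | hj0
    · simp [h]
    · rw [Function.update_of_ne hj0]
      simp only [h, if_neg hj0, if_pos (show j ≤ c₁ by omega)]
  · refine leftNormed_congr fun j hj _ => ?_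
    rw [Function.update_of_ne (by omega)]
    simp only [h, if_neg (show j ≠ 0 by omega), if_neg (show ¬ j ≤ c₁ by omega)]

theorem commutator_right_le_marginalCommutator (c₁ c₂ : ℕ) :
    ⁅weightSeries R (c₂ + 1), weightSeries (⊤ : Subgroup F) (c₁ + 1)⁆ ≤
      marginalCommutator (outerNilpotentLaws c₁ c₂) R := by
  rw [Subgroup.commutator_comm]
  refine (Subgroup.commutator_mono (weightSeries_le_closure_leftNormed ⊤ 0 c₁)
    (weightSeries_le_closure_leftNormed R (c₁ + 1) c₂)).trans (commutator_closure_le ?_)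
  rintro _ ⟨f, -, rfl⟩ _ ⟨f', hf', rfl⟩
  -- Same device, now with the first variable of the second inner commutator.
  let h (j : ℕ) : F := if j = c₁ + 1 then 1 else if j ≤ c₁ then f j else f' j
  refine Subgroup.subset_closure ⟨_, rfl, h, c₁ + 1, f' (c₁ + 1), hf', ?_⟩
  rw [lift_outerNilpotentLaw, lift_outerNilpotentLaw,
    leftNormed_eq_one (f := h) (s := c₁ + 1) (by simp [h]), commutatorElement_one_right, inv_one,
    mul_one]
  congr 1
  · refine leftNormed_congr fun j _ hj => ?_
    rw [Function.update_of_ne (by omega)]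
    simp only [h, if_neg (show j ≠ c₁ + 1 by omega), if_pos (show j ≤ c₁ by omega)]
  · refine leftNormed_congr fun j hj _ => ?_
    rcases eq_or_ne j (c₁ + 1) with rfl | hj0
    · simp [h]
    · rw [Function.update_of_ne hj0]
      simp only [h, if_neg hj0, if_neg (show ¬ j ≤ c₁ by omega)]

variable {R}

/-- By the three subgroups lemma the extra factor `F` moves into one of the two inner terms, which
then lies in the series of `R`. This makes the Baer invariant abelian and commutators bilinear
modulo `[R V* F]`. -/
theorem commutator_verbalSubgroup_top_le (hR : _root_.commutator F ≤ R) (c₁ c₂ : ℕ) :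
    ⁅verbalSubgroup (outerNilpotentLaws c₁ c₂) F, (⊤ : Subgroup F)⁆ ≤
      marginalCommutator (outerNilpotentLaws c₁ c₂) R := by
  rw [verbalSubgroup_outerNilpotentLaws]
  refine commutator_commutator_le_of_rotate ?_ ?_
  · rw [← weightSeries_succ_succ]
    exact (Subgroup.commutator_mono (weightSeries_top_le hR c₂) le_rfl).trans
      (commutator_right_le_marginalCommutator R c₁ c₂)
  · rw [Subgroup.commutator_comm ⊤, ← weightSeries_succ_succ]
    exact (Subgroup.commutator_mono (weightSeries_top_le hR c₁) le_rfl).trans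
      (commutator_left_le_marginalCommutator R c₁ c₂)

theorem verbalSubgroup_le_weightSeries (c₁ c₂ : ℕ) :
    verbalSubgroup (outerNilpotentLaws c₁ c₂) F ≤
      weightSeries (⊤ : Subgroup F) (c₁ + 1 + (c₂ + 1)) := by
  rw [verbalSubgroup_outerNilpotentLaws]
  exact commutator_weightSeries_le ⊤ _ _

theorem verbalSubgroup_le_commutator (c₁ c₂ : ℕ) :
    verbalSubgroup (outerNilpotentLaws c₁ c₂) F ≤ _root_.commutator F :=
  (verbalSubgroup_le_weightSeries c₁ c₂).trans
    (weightSeries_antitone ⊤ (by omega : 2 ≤ c₁ + 1 + (c₂ + 1)))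

theorem commutatorElement_pow_mem_weightSeries (hR : _root_.commutator F ≤ R) {m n e : ℕ}
    (hm : 1 ≤ m) (hn : 1 ≤ n) {a b : F} (ha : a ∈ weightSeries (⊤ : Subgroup F) m)
    (hb : b ∈ weightSeries (⊤ : Subgroup F) n) (he : a ^ e ∈ weightSeries R m) :
    ⁅a, b⁆ ^ e ∈ weightSeries R (m + n) := by
  refine commutatorElement_pow_mem ?_
    (commutator_weightSeries_le R _ _ (Subgroup.commutator_mem_commutator he hb))
  -- The correction `⁅a, ⁅a, b⁆⁆` has weight 2m + n ≥ m + n + 1, which leaves room for the one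
  -- weight lost in passing to `R`.
  obtain ⟨l, hl⟩ : ∃ l, m + n = l + 1 := ⟨m + n - 1, by omega⟩
  rw [hl]
  apply weightSeries_top_le hR
  exact commutator_weightSeries_le' ⊤ (by omega) (Subgroup.commutator_mem_commutator ha
    (commutator_weightSeries_le ⊤ _ _ (Subgroup.commutator_mem_commutator ha hb)))

/-- At each bracket only the factor containing the largest letter has to be raised to the power; the
other factor is arbitrary. -/
theorem bracketEval_pow_mem_weightSeries {m : ℕ} {N : ℕ → ℕ} {R : Subgroup (FreeGroup (Fin m))}
    [R.Normal] (hR : _root_.commutator (FreeGroup (Fin m)) ≤ R)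
    (hpow : ∀ i : Fin m, FreeGroup.of i ^ N i ∈ R) (t : FreeMagma (Fin m)) :
    bracketEval FreeGroup.of t ^ N (treeMax t) ∈ weightSeries R (treeLength t) := by
  induction t with
  | ih1 i => exact hpow i
  | ih2 x y hx hy =>
    change ⁅_, _⁆ ^ N (max (treeMax x) (treeMax y)) ∈ weightSeries R (treeLength x + treeLength y)
    rcases le_total (treeMax y) (treeMax x) with h | h
    · rw [max_eq_left h]
      exact commutatorElement_pow_mem_weightSeries hR (treeLength_pos x) (treeLength_pos y)
        (bracketEval_of_mem x) (bracketEval_of_mem y) hx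
    · rw [max_eq_right h, ← commutatorElement_inv, inv_pow, add_comm]
      exact inv_mem (commutatorElement_pow_mem_weightSeries hR (treeLength_pos y)
        (treeLength_pos x) (bracketEval_of_mem y) (bracketEval_of_mem x) hy)

theorem commutatorElement_pow_mem_marginalCommutator (hR : _root_.commutator F ≤ R)
    {c₁ c₂ e : ℕ} {a b : F} (ha : a ∈ weightSeries (⊤ : Subgroup F) (c₁ + 1))
    (hb : b ∈ weightSeries (⊤ : Subgroup F) (c₂ + 1))
    (he : a ^ e ∈ weightSeries R (c₁ + 1) ∨ b ^ e ∈ weightSeries R (c₂ + 1)) :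
    ⁅a, b⁆ ^ e ∈ marginalCommutator (outerNilpotentLaws c₁ c₂) R := by
  have hcomm : ⁅a, b⁆ ∈ verbalSubgroup (outerNilpotentLaws c₁ c₂) F := by
    rw [verbalSubgroup_outerNilpotentLaws]
    exact Subgroup.commutator_mem_commutator ha hb
  have key {x y : F} (hxy : ⁅x, y⁆ ∈ verbalSubgroup (outerNilpotentLaws c₁ c₂) F) :
      ⁅x, ⁅x, y⁆⁆ ∈ marginalCommutator (outerNilpotentLaws c₁ c₂) R := by
    rw [← commutatorElement_inv]
    exact inv_mem (commutator_verbalSubgroup_top_le hR c₁ c₂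
      (Subgroup.commutator_mem_commutator hxy (Subgroup.mem_top x)))
  rcases he with he | he
  · exact commutatorElement_pow_mem (key hcomm) (commutator_left_le_marginalCommutator R c₁ c₂
      (Subgroup.commutator_mem_commutator he hb))
  · rw [← commutatorElement_inv, inv_pow]
    refine inv_mem (commutatorElement_pow_mem (key ?_)
      (commutator_right_le_marginalCommutator R c₁ c₂
        (Subgroup.commutator_mem_commutator he ha)))
    rw [← commutatorElement_inv]
    exact inv_mem hcomm

section Magnus

variable {A : Type*} [Ring A] {ι : Type*} (r : ι → A)

theorem magnusCoeff_leftNormed (f : ℕ → FreeGroup ι) (s c : ℕ) :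
    magnusCoeff r (c + 1) (leftNormed f s c) = leftNormed (fun j => magnusCoeff r 1 (f j)) s c := by
  induction c with
  | zero => rfl
  | succ c ih =>
    rw [leftNormed, magnusCoeff_commutatorElement r (by omega) le_rfl
      (leftNormed_mem_weightSeries f s c) (Subgroup.mem_top _), ih]
    rfl

/-- The leading coefficient of a value of the law depends only on the linear coefficients of the
arguments, and those do not change under multiplication by elements of `R`. -/
theorem marginalCommutator_le_ker_magnusHom {R : Subgroup (FreeGroup ι)}
    (hR : ∀ g ∈ R, magnusCoeff r 1 g = 0) (c₁ c₂ : ℕ) :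
    marginalCommutator (outerNilpotentLaws c₁ c₂) R ≤
      (magnusHom r (by omega : 1 ≤ c₁ + 1 + (c₂ + 1))).ker.map (Subgroup.subtype _) := by
  have hmem (f : ℕ → FreeGroup ι) : ⁅leftNormed f 0 c₁, leftNormed f (c₁ + 1) c₂⁆ ∈
      weightSeries (⊤ : Subgroup (FreeGroup ι)) (c₁ + 1 + (c₂ + 1)) :=
    commutator_weightSeries_le ⊤ _ _ (Subgroup.commutator_mem_commutator
      (leftNormed_mem_weightSeries f 0 c₁) (leftNormed_mem_weightSeries f (c₁ + 1) c₂))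
  have hval (f : ℕ → FreeGroup ι) :
      magnusCoeff r (c₁ + 1 + (c₂ + 1)) ⁅leftNormed f 0 c₁, leftNormed f (c₁ + 1) c₂⁆
        = ⁅leftNormed (fun j => magnusCoeff r 1 (f j)) 0 c₁,
          leftNormed (fun j => magnusCoeff r 1 (f j)) (c₁ + 1) c₂⁆ := by
    rw [magnusCoeff_commutatorElement r (by omega) (by omega) (leftNormed_mem_weightSeries f 0 c₁)
      (leftNormed_mem_weightSeries f (c₁ + 1) c₂), magnusCoeff_leftNormed, magnusCoeff_leftNormed]
  unfold marginalCommutator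
  rw [Subgroup.closure_le]
  rintro _ ⟨_, rfl, f, i, g, hg, rfl⟩
  rw [lift_outerNilpotentLaw, lift_outerNilpotentLaw]
  refine ⟨⟨_, hmem _⟩ * ⟨_, hmem f⟩⁻¹, ?_, rfl⟩
  rw [SetLike.mem_coe, MonoidHom.mem_ker, map_mul, map_inv, mul_inv_eq_one]
  change Multiplicative.ofAdd (magnusCoeff r _ _) = Multiplicative.ofAdd (magnusCoeff r _ _)
  have hf : (fun j => magnusCoeff r 1 (Function.update f i (f i * g) j))
      = fun j => magnusCoeff r 1 (f j) := by
    funext j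
    rcases eq_or_ne j i with rfl | hj
    · rw [Function.update_self, magnusCoeff_mul r le_rfl (Subgroup.mem_top _)
        (Subgroup.mem_top _), hR g hg, add_zero]
    · rw [Function.update_of_ne hj]
  rw [hval, hval, hf]

end Magnus

end Laws

/-! ### Generators, relations and independence in the Baer invariant -/

section Structure

/-- An abelian group with generators `w i` in which the relations between the generators are
exactly those generated by `d i • w i = 0`. -/
theorem nonempty_addEquiv_pi_zmod {A I : Type*} [AddCommGroup A] [Fintype I] (w : I → A)
    (d : I → ℕ) (hgen : AddSubgroup.closure (Set.range w) = ⊤) (hrel : ∀ i, d i • w i = 0)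
    (hind : ∀ e : I → ℤ, ∑ i, e i • w i = 0 → ∀ i, (d i : ℤ) ∣ e i) :
    Nonempty (A ≃+ ((i : I) → ZMod (d i))) := by
  classical
  let φ : (I → ℤ) →+ A := (Fintype.linearCombination ℤ w).toAddMonoidHom
  let ψ : (I → ℤ) →+ ((i : I) → ZMod (d i)) :=
    { toFun := fun e i => (e i : ZMod (d i))
      map_zero' := by ext; simp
      map_add' := fun a b => by ext; simp }
  have hφ_apply (e : I → ℤ) : φ e = ∑ i, e i • w i := Fintype.linearCombination_apply ..
  have hφ : Function.Surjective φ := by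
    rw [← AddMonoidHom.range_eq_top, eq_top_iff, ← hgen, AddSubgroup.closure_le]
    rintro _ ⟨i, rfl⟩
    refine ⟨Pi.single i 1, ?_⟩
    rw [hφ_apply, Finset.sum_eq_single i] <;> simp +contextual
  have hψ : Function.Surjective ψ := fun y =>
    ⟨fun i => (ZMod.intCast_surjective (y i)).choose,
      funext fun i => (ZMod.intCast_surjective (y i)).choose_spec⟩
  have hker : φ.ker = ψ.ker := by
    ext e
    rw [AddMonoidHom.mem_ker, AddMonoidHom.mem_ker, hφ_apply]
    have h1 : ψ e = 0 ↔ ∀ i, (d i : ℤ) ∣ e i := by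
      rw [funext_iff]
      exact forall_congr' fun i => ZMod.intCast_zmod_eq_zero_iff_dvd _ _
    rw [h1]
    refine ⟨hind e, fun h => Finset.sum_eq_zero fun i _ => ?_⟩
    obtain ⟨c, hc⟩ := h i
    rw [hc, mul_comm, mul_smul, natCast_zsmul, hrel, smul_zero]
  exact ⟨(QuotientAddGroup.quotientKerEquivOfSurjective φ hφ).symm.trans
    ((QuotientAddGroup.quotientAddEquivOfEq hker).trans
      (QuotientAddGroup.quotientKerEquivOfSurjective ψ hψ))⟩

theorem bracketEval_ite {m : ℕ} {A : Type*} [Ring A] (f : Fin m → A) (j : ℕ)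
    (t : FreeMagma (Fin m)) :
    bracketEval (fun i : Fin m => if (i : ℕ) ≤ j then f i else 0) t =
      if treeMax t ≤ j then bracketEval f t else 0 := by
  induction t with
  | ih1 i => rfl
  | ih2 x y hx hy =>
    change ⁅_, _⁆ = if max (treeMax x) (treeMax y) ≤ j then ⁅_, _⁆ else 0
    rw [hx, hy]
    by_cases h1 : treeMax x ≤ j <;> by_cases h2 : treeMax y ≤ j <;>
      simp [h1, h2, Ring.lie_def]

variable {m : ℕ} {N : ℕ → ℕ} {R : Subgroup (FreeGroup (Fin m))}

/-- For a surviving letter `i ≤ j` the exponent sum is divisible by `N i`, hence by `N j`, and so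
vanishes in the coefficient ring. -/
theorem magnusCoeff_ite_eq_zero (hN : ∀ i j, i ≤ j → N j ∣ N i)
    (hexp : ∀ g ∈ R, ∀ i : Fin m, (N i : ℤ) ∣ (exponentSum i g).toAdd) (j : ℕ) {g : FreeGroup (Fin m)}
    (hg : g ∈ R) : magnusCoeff (fun i : Fin m =>
      if (i : ℕ) ≤ j then FreeAlgebra.ι (ZMod (N j)) i else 0) 1 g = 0 := by
  rw [magnusCoeff_one_eq_sum]
  refine Finset.sum_eq_zero fun i _ => ?_
  split_ifs with h
  · have h1 : (N j : ℤ) ∣ (exponentSum i g).toAdd :=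
      (Int.natCast_dvd_natCast.2 (hN _ _ h)).trans (hexp g hg i)
    rw [← Int.cast_smul_eq_zsmul (ZMod (N j)), (ZMod.intCast_zmod_eq_zero_iff_dvd _ _).2 h1,
      zero_smul]
  · exact smul_zero _

/-- The structure of the Baer invariant for a presentation of a direct sum of cyclic groups, in
terms of pairs of elements of a Hall set. -/
theorem nonempty_baerInvariant_mulEquiv [R.Normal] (hN : ∀ i j, i ≤ j → N j ∣ N i)
    (hcomm : _root_.commutator (FreeGroup (Fin m)) ≤ R)
    (hpow : ∀ i : Fin m, FreeGroup.of i ^ N i ∈ R)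
    (hexp : ∀ g ∈ R, ∀ i : Fin m, (N i : ℤ) ∣ (exponentSum i g).toAdd)
    {c₁ c₂ : ℕ} (hc₂₁ : c₂ ≤ c₁) (hc₁₂ : c₁ ≤ 2 * c₂)
    {S : Type} {tree : S → FreeMagma (Fin m)} {l : List (ℕ × ℕ)}
    (hS : IsHallStage tree (c₂ + 1) l) (hwt : ∀ s, c₂ + 1 ≤ treeLength (tree s))
    {I : Type*} [Fintype I] {u v : I → S} (hu : ∀ i, treeLength (tree (u i)) = c₁ + 1)
    (hv : ∀ i, treeLength (tree (v i)) = c₂ + 1)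
    (h₁ : ∀ i j, u i = u j → v i = v j → i = j) (h₂ : ∀ i j, ¬ (v i = u j ∧ u i = v j))
    (hcover : ∀ a b, treeLength (tree a) = c₁ + 1 → treeLength (tree b) = c₂ + 1 →
      a = b ∨ ∃ i, (u i = a ∧ v i = b) ∨ (u i = b ∧ v i = a)) {d : I → ℕ}
    (hd : ∀ i, N (max (treeMax (tree (u i))) (treeMax (tree (v i)))) = d i) :
    Nonempty (BaerInvariant (outerNilpotentLaws c₁ c₂) R ≃*
      Multiplicative ((i : I) → ZMod (d i))) := by
  obtain rfl : (fun i => N (max (treeMax (tree (u i))) (treeMax (tree (v i))))) = d := funext hd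
  set V := outerNilpotentLaws c₁ c₂ with hV
  set M := marginalCommutator V R with hM
  let g (s : S) : FreeGroup (Fin m) := bracketEval FreeGroup.of (tree s)
  have hgmem (s : S) {n : ℕ} (hs : treeLength (tree s) = n) :
      g s ∈ weightSeries (⊤ : Subgroup (FreeGroup (Fin m))) n := hs ▸ bracketEval_of_mem (tree s)
  have hVR : verbalSubgroup V (FreeGroup (Fin m)) ≤ R :=
    (verbalSubgroup_le_commutator c₁ c₂).trans hcomm
  have hgen (i : I) : ⁅g (u i), g (v i)⁆ ∈ R ⊓ verbalSubgroup V (FreeGroup (Fin m)) := by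
    have : ⁅g (u i), g (v i)⁆ ∈ verbalSubgroup V (FreeGroup (Fin m)) := by
      rw [hV, verbalSubgroup_outerNilpotentLaws]
      exact Subgroup.commutator_mem_commutator (hgmem _ (hu i)) (hgmem _ (hv i))
    exact ⟨hVR this, this⟩
  have hcenter := commutator_verbalSubgroup_top_le hcomm c₁ c₂
  let mk : ↥(R ⊓ verbalSubgroup V (FreeGroup (Fin m))) →* BaerInvariant V R :=
    QuotientGroup.mk' _
  have hmk (x : ↥(R ⊓ verbalSubgroup V (FreeGroup (Fin m)))) : mk x = 1 ↔ (x : FreeGroup _) ∈ M :=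
    (QuotientGroup.eq_one_iff x).trans Subgroup.mem_subgroupOf
  let : CommGroup (BaerInvariant V R) :=
    { mul_comm := by
        intro a b
        obtain ⟨x, rfl⟩ := QuotientGroup.mk'_surjective _ a
        obtain ⟨y, rfl⟩ := QuotientGroup.mk'_surjective _ b
        rw [← commutatorElement_eq_one_iff_mul_comm]
        refine ((map_commutatorElement mk x y).symm).trans ((hmk _).2 ?_)
        exact hcenter (Subgroup.commutator_mem_commutator x.2.2 (Subgroup.mem_top _)) }
  let w (i : I) : BaerInvariant V R := mk ⟨_, hgen i⟩
  have hwgen : Subgroup.closure (Set.range w) = ⊤ := by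
    -- The preimage in F of the subgroup generated by the `w i`. It contains `M` and lies in V(F),
    -- which is central modulo `M`, so it is normal.
    let K : Subgroup (FreeGroup (Fin m)) :=
      ((Subgroup.closure (Set.range w)).comap mk).map (Subgroup.subtype _)
    have hMK : M ≤ K := fun x hx =>
      ⟨⟨x, marginalCommutator_le V R hx⟩, by
        rw [SetLike.mem_coe, Subgroup.mem_comap, (hmk _).2 hx]
        exact one_mem _, rfl⟩
    have hKV : K ≤ verbalSubgroup V (FreeGroup (Fin m)) := by
      rintro _ ⟨x, _, rfl⟩
      exact x.2.2
    have hK : K.Normal := normal_of_commutator_top_le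
      (((Subgroup.commutator_mono hKV le_rfl).trans hcenter).trans hMK)
    have hgK (i : I) : ⁅g (u i), g (v i)⁆ ∈ K :=
      ⟨⟨_, hgen i⟩, Subgroup.subset_closure ⟨i, rfl⟩, rfl⟩
    -- Here `c₁ ≤ 2 * c₂` enters: it puts the weight `c₁ + 1` below `2 * (c₂ + 1)`.
    have hspan (n : ℕ) (hn : c₂ + 1 ≤ n) (hn' : n < 2 * (c₂ + 1)) :
        weightSeries (⊤ : Subgroup (FreeGroup (Fin m))) n
          ≤ thicken (g '' {s | treeLength (tree s) = n}) n := by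
      rw [← bracketSpan_eq_of_lt (g := g) hwt hn']
      exact hS.span n hn
    have hVK : verbalSubgroup V (FreeGroup (Fin m)) ≤ K := by
      rw [hV, verbalSubgroup_outerNilpotentLaws]
      refine (Subgroup.commutator_mono (hspan _ (by omega) (by omega))
        (hspan _ le_rfl (by omega))).trans (commutator_closure_le ?_)
      rintro _ (⟨a, ha, rfl⟩ | hx) y hy
      · rcases hy with ⟨b, hb, rfl⟩ | hy
        · rcases hcover a b ha hb with rfl | ⟨i, ⟨rfl, rfl⟩ | ⟨rfl, rfl⟩⟩
          · rw [commutatorElement_self]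
            exact one_mem _
          · exact hgK i
          · rw [← commutatorElement_inv]
            exact inv_mem (hgK i)
        · rw [← commutatorElement_inv]
          exact inv_mem (hMK (commutator_right_le_marginalCommutator R c₁ c₂
            (Subgroup.commutator_mem_commutator (weightSeries_top_le hcomm _ hy)
              (hgmem a ha))))
      · have hy' : y ∈ weightSeries (⊤ : Subgroup (FreeGroup (Fin m))) (c₂ + 1) := by
          rcases hy with ⟨b, hb, rfl⟩ | hy
          · exact hgmem b hb
          · exact weightSeries_antitone ⊤ (Nat.le_succ _) hy
        exact hMK (commutator_left_le_marginalCommutator R c₁ c₂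
          (Subgroup.commutator_mem_commutator (weightSeries_top_le hcomm _ hx) hy'))
    rw [eq_top_iff]
    rintro a -
    obtain ⟨x, rfl⟩ := QuotientGroup.mk'_surjective _ a
    obtain ⟨x', hx', hxx⟩ := hVK x.2.2
    rw [← Subtype.ext hxx]
    exact hx'
  have hwrel (i : I) :
      w i ^ N (max (treeMax (tree (u i))) (treeMax (tree (v i)))) = 1 := by
    rw [← map_pow, hmk]
    refine commutatorElement_pow_mem_marginalCommutator hcomm (hgmem _ (hu i)) (hgmem _ (hv i)) ?_
    rcases le_total (treeMax (tree (v i))) (treeMax (tree (u i))) with h | h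
    · rw [max_eq_left h, ← hu i]
      exact Or.inl (bracketEval_pow_mem_weightSeries hcomm hpow _)
    · rw [max_eq_right h, ← hv i]
      exact Or.inr (bracketEval_pow_mem_weightSeries hcomm hpow _)
  have hwind (e : I → ℤ) (he : ∑ i, e i • Additive.ofMul (w i) = 0) (i : I) :
      (N (max (treeMax (tree (u i))) (treeMax (tree (v i)))) : ℤ) ∣ e i := by
    set j := max (treeMax (tree (u i))) (treeMax (tree (v i))) with hj
    -- Letters after `j` must be killed: their orders may be proper divisors of `N j`, and then the
    -- linear coefficient would not vanish on `R`. For `N j = 0` the coefficients are integers.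
    let r (i : Fin m) : FreeAlgebra (ZMod (N j)) (Fin m) :=
      if (i : ℕ) ≤ j then FreeAlgebra.ι (ZMod (N j)) i else 0
    have hle : R ⊓ verbalSubgroup V (FreeGroup (Fin m))
        ≤ weightSeries (⊤ : Subgroup (FreeGroup (Fin m))) (c₁ + 1 + (c₂ + 1)) :=
      inf_le_right.trans (verbalSubgroup_le_weightSeries c₁ c₂)
    let Λ : BaerInvariant V R →* Multiplicative (FreeAlgebra (ZMod (N j)) (Fin m)) :=
      QuotientGroup.lift _ ((magnusHom r (by omega : 1 ≤ c₁ + 1 + (c₂ + 1))).comp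
        (Subgroup.inclusion hle)) (by
          intro x hx
          obtain ⟨y, hy, hyx⟩ := marginalCommutator_le_ker_magnusHom r
            (fun g hg => magnusCoeff_ite_eq_zero hN hexp j hg) c₁ c₂ (Subgroup.mem_subgroupOf.1 hx)
          rw [MonoidHom.mem_ker, MonoidHom.comp_apply, ← show y = Subgroup.inclusion hle x from Subtype.ext hyx]
          exact hy)
    let a (s : S) : FreeAlgebra (ZMod (N j)) (Fin m) := bracketEval (FreeAlgebra.ι _) (tree s)
    have hΛ (i' : I) : (Λ (w i')).toAdd =
        if max (treeMax (tree (u i'))) (treeMax (tree (v i'))) ≤ j then ⁅a (u i'), a (v i')⁆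
        else 0 := by
      -- The commutator is the value of the product tree, so its Magnus coefficient is the bracket
      -- of that tree in the `r i`.
      have h1 := bracketEval_ite (FreeAlgebra.ι (ZMod (N j))) j (tree (u i') * tree (v i'))
      have h2 := magnusCoeff_bracketEval r (tree (u i') * tree (v i'))
      refine Eq.trans ?_ h1
      refine Eq.trans ?_ h2
      change magnusCoeff r _ _ = magnusCoeff r
        (treeLength (tree (u i')) + treeLength (tree (v i'))) _
      rw [hu, hv]
      rfl
    have h3 := congrArg (MonoidHom.toAdditiveLeft Λ) he
    rw [map_sum, map_zero] at h3
    have h4 : ∑ i', (if max (treeMax (tree (u i'))) (treeMax (tree (v i'))) ≤ j then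
        (e i' : ZMod (N j)) else 0) • ⁅a (u i'), a (v i')⁆ = 0 := by
      rw [← h3]
      refine Finset.sum_congr rfl fun i' _ => ?_
      rw [map_zsmul]
      change _ = e i' • (Λ (w i')).toAdd
      rw [hΛ, ← Int.cast_smul_eq_zsmul (ZMod (N j))]
      split_ifs <;> simp
    have h5 := (hS.free (ZMod (N j))).eq_zero_of_sum_bracket h₁ h₂ h4 i
    rw [if_pos le_rfl] at h5
    exact (ZMod.intCast_zmod_eq_zero_iff_dvd _ _).1 h5
  have hwgen' := congrArg Subgroup.toAddSubgroup hwgen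
  rw [Subgroup.toAddSubgroup_closure] at hwgen'
  obtain ⟨f⟩ := nonempty_addEquiv_pi_zmod (A := Additive (BaerInvariant V R))
    (fun i => Additive.ofMul (w i)) _ hwgen' (fun i => congrArg Additive.ofMul (hwrel i)) hwind
  exact ⟨AddEquiv.toMultiplicativeRight f⟩

end Structure

/-! ### Independence of the free presentation -/

section Presentations

variable {F : Type*} [Group F]

theorem exists_forall_lift_eq (v : FreeGroup ℕ) : ∃ n : ℕ, ∀ f f' : ℕ → F,
    (∀ j < n, f j = f' j) → FreeGroup.lift f v = FreeGroup.lift f' v := by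
  induction v using FreeGroup.induction_on with
  | C1 => exact ⟨0, fun f f' _ => by simp⟩
  | of i => exact ⟨i + 1, fun f f' h => by simpa using h i (by omega)⟩
  | inv_of i ih =>
    obtain ⟨n, hn⟩ := ih
    exact ⟨n, fun f f' h => by rw [map_inv, map_inv, hn f f' h]⟩
  | mul x y hx hy =>
    obtain ⟨a, ha⟩ := hx
    obtain ⟨b, hb⟩ := hy
    exact ⟨max a b, fun f f' h => by
      rw [map_mul, map_mul, ha f f' fun j hj => h j (lt_max_of_lt_left hj),
        hb f f' fun j hj => h j (lt_max_of_lt_right hj)]⟩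

theorem lift_mul_inv_mem_marginalCommutator {V : Set (FreeGroup ℕ)} {R : Subgroup F}
    {v : FreeGroup ℕ} (hv : v ∈ V) {f f' : ℕ → F} (h : ∀ j, (f j)⁻¹ * f' j ∈ R) :
    FreeGroup.lift f' v * (FreeGroup.lift f v)⁻¹ ∈ marginalCommutator V R := by
  -- Variables are replaced one at a time; a word involves only finitely many of them.
  have key (n : ℕ) : FreeGroup.lift (fun j => if j < n then f' j else f j) v *
      (FreeGroup.lift f v)⁻¹ ∈ marginalCommutator V R := by
    induction n with
    | zero => simp
    | succ n ih =>
      let fn (j : ℕ) : F := if j < n then f' j else f j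
      have h1 : (fun j => if j < n + 1 then f' j else f j)
          = Function.update fn n (fn n * ((f n)⁻¹ * f' n)) := by
        funext j
        rcases lt_trichotomy j n with hj | rfl | hj
        · rw [Function.update_of_ne hj.ne, if_pos (by omega)]
          exact (if_pos hj).symm
        · simp [fn]
        · rw [Function.update_of_ne hj.ne', if_neg (by omega)]
          exact (if_neg (by omega)).symm
      have h2 : FreeGroup.lift (fun j => if j < n + 1 then f' j else f j) v *
          (FreeGroup.lift fn v)⁻¹ ∈ marginalCommutator V R :=
        Subgroup.subset_closure ⟨v, hv, fn, n, _, h n, by rw [h1]⟩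
      have ih' : FreeGroup.lift fn v * (FreeGroup.lift f v)⁻¹ ∈ marginalCommutator V R := ih
      simpa only [mul_assoc, inv_mul_cancel_left] using mul_mem h2 ih'
  obtain ⟨n, hn⟩ := exists_forall_lift_eq (F := F) v
  rw [← hn (fun j => if j < n then f' j else f j) f' fun j hj => if_pos hj]
  exact key n

theorem map_lift {F' : Type*} [Group F'] (φ : F →* F') (f : ℕ → F) (v : FreeGroup ℕ) :
    φ (FreeGroup.lift f v) = FreeGroup.lift (fun j => φ (f j)) v := by
  have : φ.comp (FreeGroup.lift f) = FreeGroup.lift (fun j => φ (f j)) := by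
    ext j; simp
  exact DFunLike.congr_fun this v

/-- An endomorphism inducing the identity on F/R changes the arguments of each law only by elements
of `R`, so it induces the identity on V(F)/[R V* F]. -/
theorem inv_mul_mem_marginalCommutator {V : Set (FreeGroup ℕ)} {R : Subgroup F} [R.Normal]
    {θ : F →* F} (hθ : ∀ x, x⁻¹ * θ x ∈ R) {x : F} (hx : x ∈ verbalSubgroup V F) :
    (θ x)⁻¹ * x ∈ marginalCommutator V R := by
  have hle : verbalSubgroup V F ≤ ((QuotientGroup.mk' (marginalCommutator V R)).comp θ).eqLocus
      (QuotientGroup.mk' (marginalCommutator V R)) := by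
    unfold verbalSubgroup
    rw [Subgroup.closure_le]
    rintro _ ⟨v, hv, f, rfl⟩
    change QuotientGroup.mk' _ (θ _) = QuotientGroup.mk' _ _
    rw [map_lift, ← mul_inv_eq_one, ← map_inv, ← map_mul, ← MonoidHom.mem_ker, QuotientGroup.ker_mk']
    exact lift_mul_inv_mem_marginalCommutator hv fun j => hθ (f j)
  exact QuotientGroup.eq.1 (hle hx)

variable {F' : Type*} [Group F'] {V : Set (FreeGroup ℕ)} {R : Subgroup F} {R' : Subgroup F'}

theorem verbalSubgroup_le_comap (φ : F →* F') :
    verbalSubgroup V F ≤ (verbalSubgroup V F').comap φ := by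
  rw [verbalSubgroup, Subgroup.closure_le]
  rintro _ ⟨v, hv, f, rfl⟩
  exact Subgroup.subset_closure ⟨v, hv, _, map_lift φ f v⟩

theorem marginalCommutator_le_comap {φ : F →* F'} (hφ : R ≤ R'.comap φ) :
    marginalCommutator V R ≤ (marginalCommutator V R').comap φ := by
  rw [marginalCommutator, Subgroup.closure_le]
  rintro _ ⟨v, hv, f, i, r, hr, rfl⟩
  refine Subgroup.subset_closure ⟨v, hv, fun j => φ (f j), i, φ r, hφ hr, ?_⟩
  rw [map_mul, map_inv, map_lift, map_lift]
  congr 3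
  funext j
  rcases eq_or_ne j i with rfl | hj
  · simp
  · simp [hj]

/-- The homomorphism of Baer invariants induced by a morphism of presentations. -/
def baerMap [R.Normal] [R'.Normal] (φ : F →* F') (hφ : R ≤ R'.comap φ) :
    BaerInvariant V R →* BaerInvariant V R' :=
  QuotientGroup.map _ _
    ((φ.comp (R ⊓ verbalSubgroup V F).subtype).codRestrict (R' ⊓ verbalSubgroup V F')
      fun x => ⟨hφ x.2.1, verbalSubgroup_le_comap φ x.2.2⟩)
    fun _ hx => marginalCommutator_le_comap hφ hx

theorem baerMap_baerMap [R.Normal] [R'.Normal] {φ : F →* F'} (hφ : R ≤ R'.comap φ) {ψ : F' →* F}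
    (hψ : R' ≤ R.comap ψ) (h : ∀ x, x⁻¹ * ψ (φ x) ∈ R) (a : BaerInvariant V R) :
    baerMap ψ hψ (baerMap φ hφ a) = a := by
  obtain ⟨x, rfl⟩ := QuotientGroup.mk'_surjective _ a
  refine QuotientGroup.eq.2 (Subgroup.mem_subgroupOf.2 ?_)
  exact inv_mul_mem_marginalCommutator (θ := ψ.comp φ) h x.2.2

theorem exists_lift_of_surjective {G : Type*} [Group G] [IsFreeGroup F] (π : F →* G)
    {π' : F' →* G} (hπ' : Function.Surjective π') : ∃ φ : F →* F', ∀ x, π' (φ x) = π x := by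
  refine ⟨IsFreeGroup.lift fun a => Function.surjInv hπ' (π (IsFreeGroup.of a)), fun x => ?_⟩
  refine DFunLike.congr_fun (f := π'.comp _) (g := π) (IsFreeGroup.ext_hom fun a => ?_) x
  simp [Function.surjInv_eq]

/-- The Baer invariant does not depend on the free presentation. -/
theorem nonempty_baerInvariant_ker_mulEquiv {G G' : Type*} [Group G] [Group G'] [IsFreeGroup F]
    [IsFreeGroup F'] (V : Set (FreeGroup ℕ)) (e : G ≃* G') {π : F →* G}
    (hπ : Function.Surjective π) {π' : F' →* G'} (hπ' : Function.Surjective π') :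
    Nonempty (BaerInvariant V π.ker ≃* BaerInvariant V π'.ker) := by
  obtain ⟨φ, hφ⟩ := exists_lift_of_surjective (e.toMonoidHom.comp π) hπ'
  obtain ⟨ψ, hψ⟩ := exists_lift_of_surjective (e.symm.toMonoidHom.comp π') hπ
  have hφ' : π.ker ≤ π'.ker.comap φ := fun x hx => by
    rw [Subgroup.mem_comap, MonoidHom.mem_ker, hφ, MonoidHom.comp_apply, hx, map_one]
  have hψ' : π'.ker ≤ π.ker.comap ψ := fun x hx => by
    rw [Subgroup.mem_comap, MonoidHom.mem_ker, hψ, MonoidHom.comp_apply, hx, map_one]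
  exact ⟨MulEquiv.ofBijective (baerMap φ hφ')
    (Function.bijective_iff_has_inverse.2 ⟨baerMap ψ hψ',
      baerMap_baerMap hφ' hψ' fun x => by simp [MonoidHom.mem_ker, hφ, hψ],
      baerMap_baerMap hψ' hφ' fun x => by simp [MonoidHom.mem_ker, hφ, hψ]⟩)⟩

end Presentations

/-! ### Counting unordered pairs of letters -/

section Pairs

/-- The relation on arrangements which compares first the weights and then, for equal weights, the
letters by an arbitrary well-order. -/
def PairRel {S : Type*} (wt : S → ℕ) (a b : S) : Prop :=
  wt a < wt b ∨ wt a = wt b ∧ WellOrderingRel a b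

/-- The index set of commutators `[u, v]` of letters of weights `p` and `q`. -/
def pairSet {S : Type*} (wt : S → ℕ) (p q : ℕ) : Set (S × S) :=
  {x | wt x.1 = p ∧ wt x.2 = q ∧ PairRel wt x.2 x.1}

theorem pairRel_asymm {S : Type*} {wt : S → ℕ} {a b : S} (h : PairRel wt a b) :
    ¬ PairRel wt b a := by
  rintro (h' | h') <;> rcases h with h | h
  · omega
  · omega
  · omega
  · exact asymm_of WellOrderingRel h.2 h'.2

theorem pairRel_trichotomous {S : Type*} (wt : S → ℕ) (a b : S) :
    PairRel wt a b ∨ a = b ∨ PairRel wt b a := by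
  rcases lt_trichotomy (wt a) (wt b) with h | h | h
  · exact Or.inl (Or.inl h)
  · rcases trichotomous_of WellOrderingRel a b with h' | h' | h'
    · exact Or.inl (Or.inr ⟨h, h'⟩)
    · exact Or.inr (Or.inl h')
    · exact Or.inr (Or.inr (Or.inr ⟨h.symm, h'⟩))
  · exact Or.inr (Or.inr (Or.inl h))

theorem ncard_pairSet_of_lt {S : Type*} (wt mx : S → ℕ) {p q : ℕ} (h : q < p) (i : ℕ) :
    {x ∈ pairSet wt p q | max (mx x.1) (mx x.2) < i}.ncard
      = letterCount wt mx i p * letterCount wt mx i q := by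
  rw [letterCount, letterCount, ← Set.ncard_prod]
  congr 1
  ext ⟨a, b⟩
  simp only [pairSet, PairRel, Set.mem_ofPred_eq, Set.mem_prod, max_lt_iff]
  constructor
  · rintro ⟨⟨h1, h2, -⟩, h3, h4⟩
    exact ⟨⟨h1, h3⟩, h2, h4⟩
  · rintro ⟨⟨h1, h3⟩, h2, h4⟩
    exact ⟨⟨h1, h2, Or.inl (by omega)⟩, h3, h4⟩

/-- The square of the set of letters is the disjoint union of the chosen pairs, their swaps and the
diagonal. -/
theorem ncard_pairSet_self {S : Type*} {wt : S → ℕ} (mx : S → ℕ)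
    (hfin : ∀ n, {s | wt s ≤ n}.Finite) (q i : ℕ) :
    {x ∈ pairSet wt q q | max (mx x.1) (mx x.2) < i}.ncard
      = (letterCount wt mx i q).choose 2 := by
  set T := {s | wt s = q ∧ mx s < i}
  have hT : T.Finite := (hfin q).subset fun s hs => hs.1.le
  set P := {x ∈ pairSet wt q q | max (mx x.1) (mx x.2) < i}
  have hP : P ⊆ T ×ˢ T := by
    rintro ⟨a, b⟩ ⟨⟨h1, h2, -⟩, h3⟩
    exact ⟨⟨h1, (max_lt_iff.1 h3).1⟩, h2, (max_lt_iff.1 h3).2⟩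
  have hPfin : P.Finite := (hT.prod hT).subset hP
  have hdiag : ((fun a => (a, a)) '' T).ncard = T.ncard :=
    Set.ncard_image_of_injective _ fun a b h => (Prod.ext_iff.1 h).1
  have hswap : (Prod.swap '' P).ncard = P.ncard := Set.ncard_image_of_injective _ Prod.swap_injective
  have hunion : T ×ˢ T = (P ∪ Prod.swap '' P) ∪ (fun a => (a, a)) '' T := by
    ext ⟨a, b⟩
    constructor
    · rintro ⟨ha, hb⟩
      rcases pairRel_trichotomous wt a b with h | h | h
      · exact Or.inl (Or.inr ⟨(b, a), ⟨⟨hb.1, ha.1, h⟩, max_lt hb.2 ha.2⟩, rfl⟩)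
      · exact Or.inr ⟨a, ha, by rw [h]⟩
      · exact Or.inl (Or.inl ⟨⟨ha.1, hb.1, h⟩, max_lt ha.2 hb.2⟩)
    · rintro ((h | ⟨x, hx, h⟩) | ⟨x, hx, h⟩)
      · exact hP h
      · rw [← h]
        exact (hP hx).symm
      · rw [← h]
        exact ⟨hx, hx⟩
  have h1 : (T ×ˢ T).ncard = P.ncard + P.ncard + T.ncard := by
    rw [hunion, Set.ncard_union_eq ?_ (hPfin.union (hPfin.image _)) (hT.image _),
      Set.ncard_union_eq ?_ hPfin (hPfin.image _), hdiag, hswap]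
    · rw [Set.disjoint_left]
      rintro _ hx ⟨y, hy, rfl⟩
      exact pairRel_asymm hx.1.2.2 hy.1.2.2
    · rw [Set.disjoint_left]
      rintro _ hx ⟨y, hy, rfl⟩
      rcases hx with hx | ⟨⟨c, d⟩, hx, h⟩
      · exact pairRel_asymm hx.1.2.2 hx.1.2.2
      · obtain rfl : c = d := (Prod.ext_iff.1 h).2.trans (Prod.ext_iff.1 h).1.symm
        exact pairRel_asymm hx.1.2.2 hx.1.2.2
  rw [Set.ncard_prod] at h1
  change P.ncard = T.ncard.choose 2
  rw [Nat.choose_two_right]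
  have h2 : T.ncard * (T.ncard - 1) = 2 * P.ncard := by
    rw [Nat.mul_sub, h1]
    omega
  omega

theorem wittChi_two (x : ℚ) : wittChi 2 x = x * (x - 1) / 2 := by
  have h : Nat.divisors 2 = {1, 2} := by decide
  rw [wittChi, h, Finset.sum_pair (by decide), ArithmeticFunction.moebius_apply_one,
    ArithmeticFunction.moebius_apply_prime Nat.prime_two]
  norm_num
  ring

/-- Enumeration of a finite set by the values of a function `f`, given the number of elements with
`f` less than `r` for each `r`. -/
theorem exists_bijective_of_card {I : Type*} [Finite I] (f : I → ℕ) (b : ℕ → ℕ) (k t : ℕ)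
    (hf : ∀ i, f i < k + t) (hb : ∀ r ≤ k + t, {i | f i < r}.ncard = b r) :
    ∃ E : Fin (b k) ⊕ (Σ j : Fin t, Fin (b (k + j + 1) - b (k + j))) → I,
      Function.Bijective E ∧ (∀ x, f (E (Sum.inl x)) < k) ∧
        ∀ x, f (E (Sum.inr x)) = k + x.1 := by
  have h1 : Nat.card {i | f i < k} = b k := hb k (by omega)
  have h2 (j : Fin t) : Nat.card {i | f i = k + j} = b (k + j + 1) - b (k + j) := by
    rw [← hb _ (by omega), ← hb _ (by omega)]
    have : {i | f i < k + j + 1} = {i | f i < k + j} ∪ {i | f i = k + j} := by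
      ext i
      simp only [Set.mem_ofPred_eq, Set.mem_union]
      omega
    rw [this, Set.ncard_union_eq ?_ (Set.toFinite _) (Set.toFinite _), Nat.add_sub_cancel_left]
    · rfl
    · rw [Set.disjoint_left]
      intro i hi hi'
      simp only [Set.mem_ofPred_eq] at hi hi'
      omega
  let e₁ : Fin (b k) ≃ {i | f i < k} := (Finite.equivFinOfCardEq h1).symm
  let e₂ (j : Fin t) : Fin (b (k + j + 1) - b (k + j)) ≃ {i | f i = k + j} :=
    (Finite.equivFinOfCardEq (h2 j)).symm
  refine ⟨Sum.elim (fun x => (e₁ x : I)) fun x => (e₂ x.1 x.2 : I), ⟨?_, fun i => ?_⟩,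
    fun x => (e₁ x).2, fun x => (e₂ x.1 x.2).2⟩
  · rintro (x | ⟨j, x⟩) (y | ⟨j', y⟩) h
    · simpa [Subtype.coe_inj] using h
    · have hx : f (e₁ x) < k := (e₁ x).2
      have hy : f (e₂ j' y) = k + j' := (e₂ j' y).2
      simp only [Sum.elim_inl, Sum.elim_inr] at h
      rw [h] at hx
      omega
    · have hx : f (e₁ y) < k := (e₁ y).2
      have hy : f (e₂ j x) = k + j := (e₂ j x).2
      simp only [Sum.elim_inl, Sum.elim_inr] at h
      rw [← h] at hx
      omega
    · have hx : f (e₂ j x) = k + j := (e₂ j x).2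
      have hy : f (e₂ j' y) = k + j' := (e₂ j' y).2
      simp only [Sum.elim_inr] at h
      rw [h] at hx
      obtain rfl : j = j' := Fin.ext (by omega)
      simpa [Subtype.coe_inj] using h
  · by_cases hi : f i < k
    · exact ⟨Sum.inl (e₁.symm ⟨i, hi⟩), by simp⟩
    · have := hf i
      exact ⟨Sum.inr ⟨⟨f i - k, by omega⟩,
        (e₂ _).symm ⟨i, by simp only [Set.mem_ofPred_eq]; omega⟩⟩, by simp⟩

/-- Functions on a disjoint union of a finite set and a family of finite sets. -/
def piSumSigmaEquiv {a t : ℕ} (c : Fin t → ℕ) (n : Fin t → ℕ) :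
    ((x : Fin a ⊕ (Σ j : Fin t, Fin (c j))) → ZMod (Sum.elim (fun _ => 0) (fun y => n y.1) x)) ≃+
      (Fin a → ℤ) × ((j : Fin t) → Fin (c j) → ZMod (n j)) where
  -- `ZMod 0` is ℤ by definition, so the free part needs no conversion.
  toFun h := (fun i => h (Sum.inl i), fun j i => h (Sum.inr ⟨j, i⟩))
  invFun h x := match x with
    | Sum.inl i => h.1 i
    | Sum.inr ⟨j, i⟩ => h.2 j i
  left_inv h := by
    funext x
    rcases x with i | ⟨j, i⟩ <;> rfl
  right_inv h := rfl
  map_add' h h' := rfl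

end Pairs

/-! ### The standard presentation of a direct sum of cyclic groups -/

section StandardPresentation

variable {k t : ℕ} (n : Fin t → ℕ)

/-- The orders of the standard generators, with `0` for generators of infinite order. -/
def generatorOrder (k : ℕ) (r : ℕ) : ℕ :=
  -- The values 0 at the start and 1 past the last generator extend the divisibility chain to all of
  -- ℕ.
  if r < k then 0 else if h : r - k < t then n ⟨r - k, h⟩ else 1

theorem generatorOrder_natAdd (j : Fin t) : generatorOrder n k (k + j) = n j := by
  simp [generatorOrder]

theorem generatorOrder_dvd
    (hdvd : ∀ (i : ℕ) (hi : i + 1 < t), n ⟨i + 1, hi⟩ ∣ n ⟨i, Nat.lt_of_succ_lt hi⟩)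
    (i j : ℕ) (hij : i ≤ j) : generatorOrder n k j ∣ generatorOrder n k i := by
  have key (a b : ℕ) (hab : a ≤ b) (hb : b < t) : n ⟨b, hb⟩ ∣ n ⟨a, hab.trans_lt hb⟩ := by
    induction b, hab using Nat.le_induction with
    | base => exact dvd_rfl
    | succ b hab ih => exact (hdvd b hb).trans (ih _)
  unfold generatorOrder
  by_cases hi : i < k
  · rw [if_pos hi]
    exact dvd_zero _
  · rw [if_neg hi, if_neg (by omega)]
    by_cases hj : j - k < t
    · rw [dif_pos hj, dif_pos (by omega)]
      exact key _ _ (by omega) hj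
    · rw [dif_neg hj]
      exact one_dvd _

/-- The standard presentation of a direct sum of cyclic groups. -/
def standardPresentation (k : ℕ) :
    FreeGroup (Fin (k + t)) →* Multiplicative ((Fin k → ℤ) × ((j : Fin t) → ZMod (n j))) :=
  MonoidHom.mk' (fun g => Multiplicative.ofAdd
      (fun a => (exponentSum (Fin.castAdd t a) g).toAdd,
        fun j => ((exponentSum (Fin.natAdd k j) g).toAdd : ZMod (n j))))
    fun x y => by
      rw [← ofAdd_add]
      congr 1
      ext <;> simp

theorem standardPresentation_surjective : Function.Surjective (standardPresentation n k) := by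
  intro y
  let c : Fin (k + t) → ℤ := Fin.addCases (fun a => y.toAdd.1 a)
    fun j => (ZMod.intCast_surjective (y.toAdd.2 j)).choose
  let g : FreeGroup (Fin (k + t)) := (List.ofFn fun i => FreeGroup.of i ^ c i).prod
  have hg (i : Fin (k + t)) : (exponentSum i g).toAdd = c i := by
    simp only [g, map_list_prod, List.map_ofFn, List.prod_ofFn, Function.comp_apply, map_zpow,
      exponentSum, FreeGroup.lift_apply_of, toAdd_prod, toAdd_zpow, toAdd_ofAdd]
    simp
  refine ⟨g, ?_⟩
  refine congrArg Multiplicative.ofAdd (Prod.ext (funext fun a => ?_) (funext fun j => ?_))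
  · change (exponentSum (Fin.castAdd t a) g).toAdd = _
    rw [hg]
    simp only [c, Fin.addCases_left]
    rfl
  · change ((exponentSum (Fin.natAdd k j) g).toAdd : ZMod (n j)) = _
    rw [hg]
    simp only [c, Fin.addCases_right]
    exact (ZMod.intCast_surjective (y.toAdd.2 j)).choose_spec

theorem mem_ker_standardPresentation {g : FreeGroup (Fin (k + t))} :
    g ∈ (standardPresentation n k).ker ↔
      ∀ i : Fin (k + t), (generatorOrder n k i : ℤ) ∣ (exponentSum i g).toAdd := by
  have h1 : g ∈ (standardPresentation n k).ker ↔
      (∀ a : Fin k, (exponentSum (Fin.castAdd t a) g).toAdd = 0) ∧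
        ∀ j : Fin t, ((exponentSum (Fin.natAdd k j) g).toAdd : ZMod (n j)) = 0 := by
    rw [MonoidHom.mem_ker]
    refine ⟨fun h => ?_, fun h => ?_⟩
    · have h' := congrArg Multiplicative.toAdd h
      exact ⟨fun a => congrFun (congrArg Prod.fst h') a, fun j => congrFun (congrArg Prod.snd h') j⟩
    · exact congrArg Multiplicative.ofAdd (Prod.ext (funext h.1) (funext h.2))
  rw [h1, Fin.forall_fin_add]
  refine and_congr (forall_congr' fun a => ?_) (forall_congr' fun j => ?_)
  · simp [generatorOrder]
  · rw [ZMod.intCast_zmod_eq_zero_iff_dvd, Fin.val_natAdd, generatorOrder_natAdd]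

end StandardPresentation

/-! ### Multiplicities and the final isomorphism -/

section Assembly

/-- The numbers `bᵢ`, expressed through the values of Witt's functions. -/
theorem exists_multiplicity (c₁ c₂ : ℕ) : ∃ b : ℕ → ℕ,
    (∀ i : ℕ, (b i : ℚ) = if c₂ < c₁ then wittChi (c₁ + 1) i * wittChi (c₂ + 1) i
      else wittChi 2 (wittChi (c₁ + 1) i)) ∧ Monotone b := by
  obtain ⟨w₁, hw₁, h₁⟩ := exists_monotone_eq_wittChi (Nat.le_add_left 1 c₁)
  obtain ⟨w₂, hw₂, h₂⟩ := exists_monotone_eq_wittChi (Nat.le_add_left 1 c₂)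
  by_cases hc : c₂ < c₁
  · refine ⟨fun i => w₁ i * w₂ i, fun i => ?_, fun i j hij => Nat.mul_le_mul (hw₁ hij) (hw₂ hij)⟩
    rw [if_pos hc, Nat.cast_mul, h₁, h₂]
  · refine ⟨fun i => (w₁ i).choose 2, fun i => ?_, fun i j hij => Nat.choose_le_choose 2 (hw₁ hij)⟩
    rw [if_neg hc, wittChi_two, Nat.cast_choose_two, h₁]

theorem ncard_pairSet_eq {m c₁ c₂ : ℕ} (hc₂₁ : c₂ ≤ c₁) (hc₁₂ : c₁ ≤ 2 * c₂) {S : Type}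
    {tree : S → FreeMagma (Fin m)} {l : List (ℕ × ℕ)} (hS : IsHallStage tree (c₂ + 1) l)
    (hwt : ∀ s, c₂ + 1 ≤ treeLength (tree s)) {i : ℕ} (hi : i ≤ m) :
    (({x ∈ pairSet (fun s => treeLength (tree s)) (c₁ + 1) (c₂ + 1) |
        max (treeMax (tree x.1)) (treeMax (tree x.2)) < i}.ncard : ℕ) : ℚ) =
      if c₂ < c₁ then wittChi (c₁ + 1) i * wittChi (c₂ + 1) i
      else wittChi 2 (wittChi (c₁ + 1) i) := by
  have h₁ := hS.treeCount_eq hwt hi (n := c₁ + 1) (by omega) (by omega) (by omega)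
  have h₂ := hS.treeCount_eq hwt hi (n := c₂ + 1) (by omega) le_rfl (by omega)
  rcases hc₂₁.lt_or_eq with hc | rfl
  · rw [if_pos hc, ncard_pairSet_of_lt _ (fun s => treeMax (tree s)) (by omega), Nat.cast_mul,
      ← h₁, ← h₂]
    rfl
  · rw [if_neg (lt_irrefl _), ncard_pairSet_self (fun s => treeMax (tree s)) hS.finite,
      wittChi_two, Nat.cast_choose_two, ← h₁]
    rfl

end Assembly

end OuterNilpotent

open OuterNilpotent

theorem theorem2p6 {G : Type*} [Group G] {F : Type*} [Group F] [IsFreeGroup F]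
    (c₁ c₂ k t : ℕ) (n : Fin t → ℕ)
    (hc : 1 ≤ c₂) (hc₂₁ : c₂ ≤ c₁) (hc₁₂ : c₁ ≤ 2 * c₂)
    (hn : ∀ i, 0 < n i)
    (hdvd : ∀ (i : ℕ) (hi : i + 1 < t), n ⟨i + 1, hi⟩ ∣ n ⟨i, Nat.lt_of_succ_lt hi⟩)
    (e : G ≃* Multiplicative ((Fin k → ℤ) × ((j : Fin t) → ZMod (n j))))
    (π : F →* G) (hπ : Function.Surjective π) :
    ∃ b : ℕ → ℕ,
      (∀ i : ℕ, (b i : ℚ) =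
        if c₂ < c₁ then wittChi (c₁ + 1) i * wittChi (c₂ + 1) i
        else wittChi 2 (wittChi (c₁ + 1) i)) ∧
      Monotone b ∧
      Nonempty (BaerInvariant (outerNilpotentLaws c₁ c₂) π.ker ≃*
        Multiplicative ((Fin (b k) → ℤ) ×
          ((j : Fin t) → Fin (b (k + j + 1) - b (k + j)) → ZMod (n j)))) := by
  obtain ⟨b, hb, hmono⟩ := exists_multiplicity c₁ c₂
  refine ⟨b, hb, hmono, ?_⟩
  -- All letters of weight at most `c₂` are eliminated.
  obtain ⟨S, tree, l, hS, hwt⟩ := exists_isHallStage (k + t) (Nat.le_add_left 1 c₂)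
  let wt (s : S) : ℕ := treeLength (tree s)
  let I := pairSet wt (c₁ + 1) (c₂ + 1)
  have : Finite I := by
    refine Set.Finite.to_subtype (((hS.finite (c₁ + 1)).prod (hS.finite (c₂ + 1))).subset ?_)
    exact fun x hx => ⟨hx.1.le, hx.2.1.le⟩
  let f (x : I) : ℕ := max (treeMax (tree x.1.1)) (treeMax (tree x.1.2))
  have hcount (r : ℕ) (hr : r ≤ k + t) : {x : I | f x < r}.ncard = b r := by
    have h1 := ncard_pairSet_eq hc₂₁ hc₁₂ hS hwt hr
    rw [← hb, Nat.cast_inj] at h1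
    rw [← h1, ← Set.ncard_image_of_injective _ Subtype.val_injective]
    congr 1
    ext x
    simp only [Set.mem_image, Subtype.exists, exists_and_right, exists_eq_right, Set.mem_ofPred_eq]
    exact ⟨fun ⟨h, h'⟩ => ⟨h, h'⟩, fun ⟨h, h'⟩ => ⟨h, h'⟩⟩
  obtain ⟨E, hE, hEl, hEr⟩ := exists_bijective_of_card f b k t
    (fun x => max_lt (treeMax_lt _) (treeMax_lt _)) hcount
  have hker {g : FreeGroup (Fin (k + t))} := mem_ker_standardPresentation n (k := k) (g := g)
  obtain ⟨Φ⟩ := nonempty_baerInvariant_mulEquiv (R := (standardPresentation n k).ker)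
    (generatorOrder_dvd n hdvd) (Abelianization.commutator_subset_ker _)
    (fun i => hker.2 fun i' => by
      rw [map_pow, exponentSum, FreeGroup.lift_apply_of]
      by_cases h : i = i'
      · simp [h]
      · simp [h])
    (fun g hg => hker.1 hg) hc₂₁ hc₁₂ hS hwt (u := fun x => (E x).1.1) (v := fun x => (E x).1.2)
    (fun x => (E x).2.1) (fun x => (E x).2.2.1)
    (fun x y h h' => hE.1 (Subtype.ext (Prod.ext h h')))
    (fun x y h => pairRel_asymm (E x).2.2.2 (by rw [h.1, h.2]; exact (E y).2.2.2))
    (fun x y hx hy => by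
      have key {x y : S} (hx : wt x = c₁ + 1) (hy : wt y = c₂ + 1) (h : PairRel wt y x) :
          ∃ z, (E z).1 = (x, y) :=
        (hE.2 ⟨(x, y), hx, hy, h⟩).imp fun z hz => by rw [hz]
      rcases pairRel_trichotomous wt y x with h | h | h
      · obtain ⟨z, hz⟩ := key hx hy h
        exact Or.inr ⟨z, Or.inl (by simp [hz])⟩
      · exact Or.inl h.symm
      -- With `c₂ ≤ c₁` this forces equal weights, so the swapped pair is an admissible index.
      · have hxy : wt x ≤ wt y := by rcases h with h | h <;> omega
        have hx' : wt x = c₁ + 1 := hx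
        have hy' : wt y = c₂ + 1 := hy
        obtain ⟨z, hz⟩ := key (x := y) (y := x) (by omega) (by omega) h
        exact Or.inr ⟨z, Or.inr (by simp [hz])⟩)
    (d := Sum.elim (fun _ => 0) fun y => n y.1) (by
      rintro (x | x)
      · exact if_pos (hEl x)
      · exact (congrArg _ (hEr x)).trans (generatorOrder_natAdd n x.1))
  obtain ⟨Ψ⟩ := nonempty_baerInvariant_ker_mulEquiv (outerNilpotentLaws c₁ c₂) e hπ
    (standardPresentation_surjective n)
  exact ⟨Ψ.trans (Φ.trans (AddEquiv.toMultiplicative (piSumSigmaEquiv _ n)))⟩
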